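/- **Setting.** Let $(Y,\mathbf X,\mathbf Z)\sim P$ with $Y$ real, $\mathbf X\in\mathbb R^d$ and $\mathbf Z$ in a measurable space, let $\widehat f$ be a fixed measurable prediction rule $\mathbf z\mapsto \widehat f(\mathbf z)\in\mathbb R$ (arbitrary otherwise), let $\psi(y,\mathbf x;\theta)\in\mathbb R^q$ be an estimating function, $\Theta\subset\mathbb R^q$, $\theta_0\in\Theta$, and $\omega\in\mathbb R^q$. One observes labeled data $(y_i,\mathbf x_i,\mathbf z_i)$, $1\le i\le n$, and unlabeled data $(\mathbf x_i,\mathbf z_i)$, $n<i\le n+N$, where $N=N_n$. For weights $w\in\mathbb R^q$ put $$\Psi_n^{w}(\theta)=\frac1n\sum_{i=1}^n\psi(y_i,\mathbf x_i;\theta)+\operatorname{diag}(w)\Big\{-\frac1n\sum_{i=1}^n\psi(\widehat f(\mathbf z_i),\mathbf x_i;\theta)+\frac1N\sum_{i=n+1}^{n+N}\psi(\widehat f(\mathbf z_i),\mathbf x_i;\theta)\Big\}.$$ **Conditions.** - (C1) $\Theta$ is compact and $\theta_0$ is the unique $\theta\in\Theta$ with $\mathbb E\,\psi(Y,\mathbf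 X;\theta)=0$. - (C2) With probability tending to one as $n\to\infty$, $\Psi_n^{\widehat\omega_n}$ is continuous on $\Theta$ and $\Psi_n^{\widehat\omega_n}(\theta)=0$ has exactly one solution in $\Theta$; $\widehat\theta_n$ is a random vector that, almost surely, solves this equation in $\Theta$ whenever it has a solution there. - (C3) $\sup_{\theta\in\Theta}\mathbb E\|\psi(Y,\mathbf X;\theta)\|^2<\infty$, $\sup_{\theta\in\Theta}\mathbb E\|\operatorname{diag}(\omega)\psi(\widehat f(\mathbf Z),\mathbf X;\theta)\|^2<\infty$, and $\mathbb E\|\psi(\widehat f(\mathbf Z),\mathbf X;\theta_0)\|^2<\infty$. - (C4) The labeled data are i.i.d. with law $P$, the unlabeled data are i.i.d. with the law of $(\mathbf X,\mathbf Z)$ under $P$, and the two samples are independent. - (C5) There is an open ball $B\subseteq\Theta$ centred at $\theta_0$ such that, almost surely, $\theta\mapsto\psi(Y,\mathbf X;\theta)$ and $\theta\mapsto\psi(\widehat f(\mathbf Z),\mathbf X;\theta)$ are continuously differentiable on $B$, with $\mathbb E\sup_{\theta\in B}\|\partial\psi(Y,\mathbf X;\theta)/\partial\theta\|<\infty$ and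 $\mathbb E\sup_{\theta\in B}\|\partial\psi(\widehat f(\mathbf Z),\mathbf X;\theta)/\partial\theta\|<\infty$; and $\mathbf A=\mathbb E[\partial\psi(Y,\mathbf X;\theta_0)/\partial\theta]$ is nonsingular. - $N\to\infty$ and $n/N\to\rho\in[0,\infty)$ as $n\to\infty$, and $\widehat\omega_n\to_P\omega$. **Asymptotic covariance.** Let $\Sigma(\omega)=\mathbf A^{-1}\mathbf V(\omega)\mathbf A^{-\mathrm T}$, where, with $D=\operatorname{diag}(\omega)$, $$\mathbf V(\omega)=\mathbf M_1+D(\mathbf M_2+\rho\,\mathbf M_3)D-(D\mathbf M_4^{\mathrm T}+\mathbf M_4D),$$ $\mathbf M_1=\operatorname{Var}[\psi(Y,\mathbf X;\theta_0)]$, $\mathbf M_2=\mathbf M_3=\operatorname{Var}[\psi(\widehat f(\mathbf Z),\mathbf X;\theta_0)]$ (in the labeled and in the unlabeled population, respectively) and $\mathbf M_4=\operatorname{Cov}[\psi(Y,\mathbf X;\theta_0),\psi(\widehat f(\mathbf Z),\mathbf X;\theta_0)]$. **Claim.** Let $\widehat\Sigma_n$ be random $q\times q$ matrices with $\widehat\Sigma_n\to_P\Sigma(\omega)$,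 let $\alpha\in(0,1)$, and let $z_{1-\alpha/2}$ be the $(1-\alpha/2)$-quantile of the standard normal distribution. Then for every $j\in\{1,\dots,q\}$ with $\Sigma(\omega)_{jj}>0$, the limit below exists and $$\lim_{n\to\infty}\mathbb P\Big(\theta_{0,j}\in\Big(\widehat\theta_{n,j}-z_{1-\alpha/2}\sqrt{\widehat\Sigma_{n,jj}/n},\ \ \widehat\theta_{n,j}+z_{1-\alpha/2}\sqrt{\widehat\Sigma_{n,jj}/n}\Big)\Big)\ \ge\ 1-\alpha .$$ -/

import Mathlib

open MeasureTheory ProbabilityTheory Filter Topology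

noncomputable section

/-- A complete observation `(y, x, z)`: scalar outcome, `d`-dimensional covariate, auxiliary
variable with values in `Z`. -/
abbrev Obs (d : ℕ) (Z : Type*) : Type _ := ℝ × EuclideanSpace ℝ (Fin d) × Z

/-- An observation `(x, z)` without outcome. -/
abbrev UnlabObs (d : ℕ) (Z : Type*) : Type _ := EuclideanSpace ℝ (Fin d) × Z

/-- A user-defined estimating function `ψ(y, x; θ)` with values in `ℝ^q`. -/
abbrev EstFun (d q : ℕ) : Type :=
  ℝ → EuclideanSpace ℝ (Fin d) → EuclideanSpace ℝ (Fin q) → EuclideanSpace ℝ (Fin q)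

/-- `diag(ω) v`. -/
def diagMul {q : ℕ} (ω v : EuclideanSpace ℝ (Fin q)) : EuclideanSpace ℝ (Fin q) :=
  WithLp.toLp 2 (fun k => ω k * v k)

section Population

variable {d q : ℕ} {Z : Type*}

/-- `ψ(y, x; θ)` as a function of a complete observation. -/
def psiY (ψ : EstFun d q) (θ : EuclideanSpace ℝ (Fin q)) (o : Obs d Z) :
    EuclideanSpace ℝ (Fin q) :=
  ψ o.1 o.2.1 θ

/-- `ψ(f(z), x; θ)` as a function of an observation without outcome. -/
def psiF (ψ : EstFun d q) (f : Z → ℝ) (θ : EuclideanSpace ℝ (Fin q)) (u : UnlabObs d Z) :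
    EuclideanSpace ℝ (Fin q) :=
  ψ (f u.2) u.1 θ

/-- The sample estimating function with weights `ω`, based on the first `n` labeled observations
`L 0, …, L (n - 1)` and the first `N` unlabeled observations `U 0, …, U (N - 1)`. -/
def pspaFun (ψ : EstFun d q) (f : Z → ℝ) (n N : ℕ) (L : ℕ → Obs d Z) (U : ℕ → UnlabObs d Z)
    (ω θ : EuclideanSpace ℝ (Fin q)) : EuclideanSpace ℝ (Fin q) :=
  (n : ℝ)⁻¹ • ∑ i ∈ Finset.range n, psiY ψ θ (L i)
    + diagMul ω (-((n : ℝ)⁻¹ • ∑ i ∈ Finset.range n, psiF ψ f θ (L i).2)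
        + (N : ℝ)⁻¹ • ∑ i ∈ Finset.range N, psiF ψ f θ (U i))

variable [MeasurableSpace Z]

/-- `A = E[∂ψ(Y, X; θ)/∂θ]`: the entry `(i, j)` is the mean of the `j`-th partial derivative of the
`i`-th component of `ψ`. -/
def matA (P : Measure (Obs d Z)) (ψ : EstFun d q) (θ : EuclideanSpace ℝ (Fin q)) :
    Matrix (Fin q) (Fin q) ℝ :=
  Matrix.of fun i j => ∫ o, fderiv ℝ (ψ o.1 o.2.1) θ (EuclideanSpace.single j 1) i ∂P

/-- `M₁ = Var[ψ(Y, X; θ)]`. -/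
def matM1 (P : Measure (Obs d Z)) (ψ : EstFun d q) (θ : EuclideanSpace ℝ (Fin q)) :
    Matrix (Fin q) (Fin q) ℝ :=
  Matrix.of fun i j => cov[fun o => psiY ψ θ o i, fun o => psiY ψ θ o j; P]

/-- `M₂ = Var[ψ(f(Z), X; θ)]` in the labeled population. -/
def matM2 (P : Measure (Obs d Z)) (ψ : EstFun d q) (f : Z → ℝ)
    (θ : EuclideanSpace ℝ (Fin q)) : Matrix (Fin q) (Fin q) ℝ :=
  Matrix.of fun i j => cov[fun o => psiF ψ f θ o.2 i, fun o => psiF ψ f θ o.2 j; P]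

/-- `M₃ = Var[ψ(f(Z), X; θ)]` in the unlabeled population, whose law is the `(X, Z)`-marginal. -/
def matM3 (P : Measure (Obs d Z)) (ψ : EstFun d q) (f : Z → ℝ)
    (θ : EuclideanSpace ℝ (Fin q)) : Matrix (Fin q) (Fin q) ℝ :=
  Matrix.of fun i j =>
    cov[fun u => psiF ψ f θ u i, fun u => psiF ψ f θ u j; P.map Prod.snd]

/-- `M₄ = Cov[ψ(Y, X; θ), ψ(f(Z), X; θ)]`. -/
def matM4 (P : Measure (Obs d Z)) (ψ : EstFun d q) (f : Z → ℝ)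
    (θ : EuclideanSpace ℝ (Fin q)) : Matrix (Fin q) (Fin q) ℝ :=
  Matrix.of fun i j => cov[fun o => psiY ψ θ o i, fun o => psiF ψ f θ o.2 j; P]

open scoped Matrix in
/-- `V(ω) = M₁ + diag(ω) (M₂ + ρ M₃) diag(ω) - (diag(ω) M₄ᵀ + M₄ diag(ω))`. -/
def matV (P : Measure (Obs d Z)) (ψ : EstFun d q) (f : Z → ℝ) (ρ : ℝ)
    (ω θ : EuclideanSpace ℝ (Fin q)) : Matrix (Fin q) (Fin q) ℝ :=
  matM1 P ψ θ
    + Matrix.diagonal ω * (matM2 P ψ f θ + ρ • matM3 P ψ f θ) * Matrix.diagonal ω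
    - (Matrix.diagonal ω * (matM4 P ψ f θ)ᵀ + matM4 P ψ f θ * Matrix.diagonal ω)

open scoped Matrix in
/-- The asymptotic covariance matrix `Σ(ω) = A⁻¹ V(ω) (A⁻¹)ᵀ`. -/
def asympCov (P : Measure (Obs d Z)) (ψ : EstFun d q) (f : Z → ℝ) (ρ : ℝ)
    (ω θ : EuclideanSpace ℝ (Fin q)) : Matrix (Fin q) (Fin q) ℝ :=
  (matA P ψ θ)⁻¹ * matV P ψ f ρ ω θ * ((matA P ψ θ)⁻¹)ᵀ

/-- A family `g o` of maps `ℝ^q → ℝ^q` is, for almost every `o`, continuously differentiable on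
the open ball `B(θ₀, r)`, with derivatives dominated on the ball by an integrable function. -/
def DominatedC1On (P : Measure (Obs d Z))
    (g : Obs d Z → EuclideanSpace ℝ (Fin q) → EuclideanSpace ℝ (Fin q))
    (θ₀ : EuclideanSpace ℝ (Fin q)) (r : ℝ) : Prop :=
  (∀ᵐ o ∂P, ContDiffOn ℝ 1 (g o) (Metric.ball θ₀ r)) ∧
    ∃ h : Obs d Z → ℝ, Integrable h P ∧
      ∀ᵐ o ∂P, ∀ θ ∈ Metric.ball θ₀ r, ‖fderiv ℝ (g o) θ‖ ≤ h o

/-- The conditions on the population, the estimating function and the prediction rule.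
`P` is the law of `(Y, X, Z)`, `Θ` the parameter space, `θ₀` the true parameter and `ω` the
(limiting) weight vector. -/
structure PopulationConditions (P : Measure (Obs d Z)) (ψ : EstFun d q) (f : Z → ℝ)
    (Θ : Set (EuclideanSpace ℝ (Fin q))) (θ₀ ω : EuclideanSpace ℝ (Fin q)) : Prop where
  measurable_pred : Measurable f
  measurable_psi : ∀ θ ∈ Θ,
    Measurable fun p : ℝ × EuclideanSpace ℝ (Fin d) => ψ p.1 p.2 θ
  compact : IsCompact Θ
  mem : θ₀ ∈ Θ
  zero : ∫ o, psiY ψ θ₀ o ∂P = 0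
  unique : ∀ θ ∈ Θ, ∫ o, psiY ψ θ o ∂P = 0 → θ = θ₀
  moment_psiY : ∃ C : NNReal, ∀ θ ∈ Θ, ∫⁻ o, ‖psiY ψ θ o‖ₑ ^ 2 ∂P ≤ C
  moment_psiF : ∃ C : NNReal, ∀ θ ∈ Θ, ∫⁻ o, ‖diagMul ω (psiF ψ f θ o.2)‖ₑ ^ 2 ∂P ≤ C
  /-- The covariance matrices that involve `ψ(f(Z), X; θ₀)` exist. -/
  memLp_psiF : MemLp (fun o : Obs d Z => psiF ψ f θ₀ o.2) 2 P
  smooth : ∃ r > 0, Metric.ball θ₀ r ⊆ Θ ∧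
    DominatedC1On P (fun o => ψ o.1 o.2.1) θ₀ r ∧
    DominatedC1On P (fun o => ψ (f o.2.2) o.2.1) θ₀ r
  nonsingular : (matA P ψ θ₀).det ≠ 0

/-- The labeled data `L` are i.i.d. with law `P`, the unlabeled data `U` are i.i.d. with the law of
the last two coordinates under `P`, and the two samples are independent. -/
structure IsSample {S : Type*} [MeasurableSpace S] (μ : Measure S) (P : Measure (Obs d Z))
    (L : ℕ → S → Obs d Z) (U : ℕ → S → UnlabObs d Z) : Prop where
  measurable_labeled : ∀ i, Measurable (L i)
  measurable_unlabeled : ∀ i, Measurable (U i)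
  law_labeled : ∀ i, μ.map (L i) = P
  law_unlabeled : ∀ i, μ.map (U i) = P.map Prod.snd
  indep_labeled : iIndepFun L μ
  indep_unlabeled : iIndepFun U μ
  indep : IndepFun (fun s i => L i s) (fun s i => U i s) μ

end Population

/-- The quantile function of the standard normal distribution (for `0 < p < 1`). -/
def stdNormalQuantile (p : ℝ) : ℝ := sInf {x : ℝ | p ≤ cdf (gaussianReal 0 1) x}

/-- The Wald interval `(t ± z_{1-α/2} √(v / n))`. -/
def waldInterval (α : ℝ) (n : ℕ) (t v : ℝ) : Set ℝ :=
  Set.Ioo (t - stdNormalQuantile (1 - α / 2) * √(v / n))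
    (t + stdNormalQuantile (1 - α / 2) * √(v / n))

end

/-! The estimator is located by a quantitative inverse function theorem and then expanded to first
order. Convergence in probability is convergence along the filter `whp μ` on `ℕ × S`, so the
calculus of `O` and `o` applies to random quantities directly.

With probability tending to one, the increments of the sample estimating function near `θ₀` are
those of `A` up to an arbitrarily small Lipschitz error (`exists_approximatesLinearOn`). Indeed `C¹`
gives strict differentiability, domination makes the linearization error small in mean, and the law
of large numbers transfers this to the sample. The correction term adds no derivative in the limit,
because its labeled and unlabeled averages have the same mean. The sample function tends to 0 at
`θ₀` and `A` is invertible, so it has a zero near `θ₀`; uniqueness of the zero in `Θ` makes this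
zero the estimator. Consistency is thus obtained locally, and the same approximation gives `θhat -
θ₀ = -A⁻¹ Ψ(θ₀) + o(Ψ(θ₀))` (`isLittleO_zero_expansion`).

After scaling by `√n`, the estimated weights can be replaced by `ω`, since they multiply a centered
term that is bounded in probability. What remains is a sum of two independent normalized averages,
with a Gaussian limit (`IsIID.tendstoInDistribution_add`) whose variance is the diagonal entry of
`Σ(ω)` (`variance_influence`). Slutsky's theorem then gives the limiting coverage
(`tendsto_measureReal_waldInterval`), and symmetry of the normal law bounds it below by `1 - α`. -/

open Asymptotics

/-! ### Convergence and boundedness in probability through a filter. -/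

section HighProbability

variable {S : Type*} [MeasurableSpace S] {μ : Measure S}

/-- The filter of families of events `E n` whose probability tends to one. Convergence along it to
a constant is convergence in probability. -/
def whp (μ : Measure S) : Filter (ℕ × S) where
  sets := {E | Tendsto (fun n => μ {s | (n, s) ∉ E}) atTop (𝓝 0)}
  univ_sets := by simp
  sets_of_superset := by
    intro E F hE hEF
    refine tendsto_of_tendsto_of_tendsto_of_le_of_le tendsto_const_nhds hE (fun _ => zero_le)
      fun n => measure_mono fun s hs h => hs (hEF h)
  inter_sets := by
    intro E F hE hF
    have h := Tendsto.add (Set.mem_ofPred.1 hE) (Set.mem_ofPred.1 hF)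
    rw [add_zero] at h
    refine tendsto_of_tendsto_of_tendsto_of_le_of_le tendsto_const_nhds h (fun _ => zero_le)
      fun n => (measure_mono fun s hs => ?_).trans (measure_union_le _ _)
    by_contra hc
    simp only [Set.mem_union, Set.mem_ofPred_eq, not_or, not_not] at hc
    exact hs hc

lemma eventually_whp_iff {p : ℕ × S → Prop} :
    (∀ᶠ x in whp μ, p x) ↔ Tendsto (fun n => μ {s | ¬ p (n, s)}) atTop (𝓝 0) :=
  Iff.rfl

lemma eventually_whp_of_tendsto {p : ℕ → S → Prop}
    (h : Tendsto (fun n => μ {s | ¬ p n s}) atTop (𝓝 0)) : ∀ᶠ x in whp μ, p x.1 x.2 :=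
  h

lemma eventually_whp_of_ae {p : ℕ → S → Prop} (h : ∀ n, ∀ᵐ s ∂μ, p n s) :
    ∀ᶠ x in whp μ, p x.1 x.2 := by
  rw [eventually_whp_iff]
  simp_rw [fun n => ae_iff.1 (h n)]
  exact tendsto_const_nhds

lemma eventually_whp_snd_of_ae {p : S → Prop} (h : ∀ᵐ s ∂μ, p s) : ∀ᶠ x in whp μ, p x.2 :=
  eventually_whp_of_ae (p := fun _ => p) fun _ => h

/-- An event that depends on `n` alone has empty complement for large `n`. This lets deterministic
limits in `n` be used along `whp μ`. -/
lemma tendsto_fst_whp : Tendsto Prod.fst (whp μ) atTop := by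
  intro E hE
  rw [mem_map]
  change Tendsto _ _ _
  refine tendsto_const_nhds.congr' ?_
  filter_upwards [hE] with n hn
  simp [hn]

variable {E F : Type*}

/-- Both sides unfold to the same statement about the events where the distance is at least `ε`, so
no measurability is needed. -/
lemma tendsto_whp_iff_tendstoInMeasure [PseudoEMetricSpace E] {X : ℕ → S → E} {c : E} :
    Tendsto (fun p : ℕ × S => X p.1 p.2) (whp μ) (𝓝 c) ↔
      TendstoInMeasure μ X atTop fun _ => c := by
  rw [EMetric.tendsto_nhds]
  simp only [eventually_whp_iff, not_lt, TendstoInMeasure]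

variable [NormedAddCommGroup E] [NormedAddCommGroup F]

/-- Boundedness in probability, `X n = O_P(1)`. -/
def BddInProb (μ : Measure S) (X : ℕ → S → E) : Prop :=
  ∀ ε : ENNReal, 0 < ε → ∃ M : ℝ, ∀ᶠ n in atTop, μ {s | M < ‖X n s‖} ≤ ε

lemma BddInProb.of_isBigO {X : ℕ → S → E} {Y : ℕ → S → F} (hY : BddInProb μ Y)
    (h : (fun p : ℕ × S => X p.1 p.2) =O[whp μ] fun p => Y p.1 p.2) : BddInProb μ X := by
  intro ε hε
  obtain ⟨M, hM⟩ := hY (ε / 2) (ENNReal.half_pos hε.ne')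
  obtain ⟨c, hc, hcX⟩ := h.exists_nonneg
  refine ⟨c * M, ?_⟩
  have h1 := (eventually_whp_iff.1 hcX.bound).eventually_le_const (ENNReal.half_pos hε.ne')
  filter_upwards [hM, h1] with n hn hn1
  calc μ {s | c * M < ‖X n s‖}
      ≤ μ ({s | M < ‖Y n s‖} ∪ {s | ¬ ‖X n s‖ ≤ c * ‖Y n s‖}) := by
        refine measure_mono fun s hs => ?_
        by_contra hc'
        simp only [Set.mem_union, Set.mem_ofPred_eq, not_or, not_not, not_lt] at hc' hs
        exact absurd (hs.trans_le (hc'.2.trans (by gcongr; exact hc'.1))) (lt_irrefl _)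
    _ ≤ ε / 2 + ε / 2 := (measure_union_le _ _).trans (add_le_add hn hn1)
    _ = ε := ENNReal.add_halves ε

/-- Off an event of probability `ε / 2` the norm of `X` is at most `M`, and off another one `R` is
at most a multiple of `X` as small as desired: `o(O_P(1)) = o_P(1)`. -/
lemma BddInProb.tendsto_zero_of_isLittleO {X : ℕ → S → F} {R : ℕ → S → E} (hX : BddInProb μ X)
    (h : (fun p : ℕ × S => R p.1 p.2) =o[whp μ] fun p => X p.1 p.2) :
    Tendsto (fun p : ℕ × S => R p.1 p.2) (whp μ) (𝓝 0) := by
  rw [Metric.tendsto_nhds]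
  intro δ hδ
  rw [eventually_whp_iff, ENNReal.tendsto_nhds_zero]
  intro ε hε
  obtain ⟨M, hM⟩ := hX (ε / 2) (ENNReal.half_pos hε.ne')
  set K := max M 1
  have hK : 0 < K := lt_max_of_lt_right one_pos
  have h1 := h.def (c := δ / (2 * K)) (by positivity)
  filter_upwards [hM, (eventually_whp_iff.1 h1).eventually_le_const (ENNReal.half_pos hε.ne')]
    with n hn hn1
  calc μ {s | ¬ dist (R n s) 0 < δ}
      ≤ μ ({s | M < ‖X n s‖} ∪ {s | ¬ ‖R n s‖ ≤ δ / (2 * K) * ‖X n s‖}) := by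
        refine measure_mono fun s hs => ?_
        by_contra hc'
        simp only [Set.mem_union, Set.mem_ofPred_eq, not_or, not_not, not_lt, dist_zero_right]
          at hc' hs
        have h2 : ‖R n s‖ ≤ δ / (2 * K) * K :=
          hc'.2.trans (by gcongr; exact hc'.1.trans (le_max_left _ _))
        have h3 : δ / (2 * K) * K = δ / 2 := by field_simp
        linarith
    _ ≤ ε / 2 + ε / 2 := (measure_union_le _ _).trans (add_le_add hn hn1)
    _ = ε := ENNReal.add_halves ε

lemma BddInProb.add {X Y : ℕ → S → E} (hX : BddInProb μ X) (hY : BddInProb μ Y) :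
    BddInProb μ fun n s => X n s + Y n s := by
  intro ε hε
  obtain ⟨M, hM⟩ := hX (ε / 2) (ENNReal.half_pos hε.ne')
  obtain ⟨K, hK⟩ := hY (ε / 2) (ENNReal.half_pos hε.ne')
  refine ⟨M + K, ?_⟩
  filter_upwards [hM, hK] with n hn hn1
  calc μ {s | M + K < ‖X n s + Y n s‖}
      ≤ μ ({s | M < ‖X n s‖} ∪ {s | K < ‖Y n s‖}) := by
        refine measure_mono fun s hs => ?_
        by_contra hc'
        simp only [Set.mem_union, Set.mem_ofPred_eq, not_or, not_lt] at hc' hs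
        linarith [norm_add_le (X n s) (Y n s)]
    _ ≤ ε / 2 + ε / 2 := (measure_union_le _ _).trans (add_le_add hn hn1)
    _ = ε := ENNReal.add_halves ε

lemma BddInProb.neg {X : ℕ → S → E} (hX : BddInProb μ X) : BddInProb μ fun n s => -X n s := by
  simpa [BddInProb] using hX

lemma BddInProb.sum {ι : Type*} (t : Finset ι) {X : ι → ℕ → S → E}
    (hX : ∀ i ∈ t, BddInProb μ (X i)) : BddInProb μ fun n s => ∑ i ∈ t, X i n s := by
  classical
  induction t using Finset.induction_on with
  | empty => exact fun ε _ => ⟨0, by simp⟩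
  | insert a t ha ih =>
    simp only [Finset.sum_insert ha]
    exact (hX a (Finset.mem_insert_self _ _)).add
      (ih fun i hi => hX i (Finset.mem_insert_of_mem hi))

lemma BddInProb.comp {X : ℕ → S → E} (hX : BddInProb μ X) {N : ℕ → ℕ}
    (hN : Tendsto N atTop atTop) : BddInProb μ fun n => X (N n) := fun ε hε =>
  (hX ε hε).imp fun _ h => hN.eventually h

lemma BddInProb.map_clm [NormedSpace ℝ E] [NormedSpace ℝ F] {X : ℕ → S → E}
    (h : BddInProb μ X) (T : E →L[ℝ] F) : BddInProb μ fun n s => T (X n s) :=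
  h.of_isBigO (T.isBigO_comp _ _)

lemma BddInProb.of_apply {q : ℕ} {X : ℕ → S → EuclideanSpace ℝ (Fin q)}
    (h : ∀ k, BddInProb μ fun n s => X n s k) : BddInProb μ X := by
  have h1 : BddInProb μ fun n s => ∑ k, EuclideanSpace.single k (X n s k) := by
    refine BddInProb.sum _ fun k _ => (h k).of_isBigO (IsBigO.of_bound 1 (.of_forall fun p => ?_))
    rw [PiLp.norm_single, one_mul]
  convert! h1 using 3 with n s
  ext i
  simp [Finset.sum_apply, Pi.single_apply]

end HighProbability

/-! ### Sample means of i.i.d. variables: law of large numbers and the `√n` rate. -/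

section Averages

variable {S : Type*} [MeasurableSpace S] {μ : Measure S} {V : Type*} [MeasurableSpace V]

/-- The variables `X i` are i.i.d. with law `Q`. -/
structure IsIID (μ : Measure S) (Q : Measure V) (X : ℕ → S → V) : Prop where
  measurable : ∀ i, Measurable (X i)
  law : ∀ i, μ.map (X i) = Q
  indep : iIndepFun X μ

/-- The mean of the first `n` terms of a sequence. -/
noncomputable def avg {E : Type*} [AddCommMonoid E] [Module ℝ E] (n : ℕ) (x : ℕ → E) : E :=
  (n : ℝ)⁻¹ • ∑ i ∈ Finset.range n, x i

section Algebra

variable {E F : Type*} [NormedAddCommGroup E] [NormedSpace ℝ E] [NormedAddCommGroup F]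
  [NormedSpace ℝ F]

lemma avg_sub (n : ℕ) (x y : ℕ → E) : avg n (fun i => x i - y i) = avg n x - avg n y := by
  simp [avg, Finset.sum_sub_distrib, smul_sub]

lemma map_avg (c : E →L[ℝ] F) (n : ℕ) (x : ℕ → E) : c (avg n x) = avg n fun i => c (x i) := by
  simp [avg, map_sum]

lemma avg_const {n : ℕ} (hn : n ≠ 0) (x : E) : avg n (fun _ => x) = x := by
  have : (n : ℝ) ≠ 0 := by exact_mod_cast hn
  simp [avg, ← Nat.cast_smul_eq_nsmul ℝ, smul_smul, this]

lemma norm_avg_le (n : ℕ) (x : ℕ → E) : ‖avg n x‖ ≤ avg n fun i => ‖x i‖ := by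
  rw [avg, avg, norm_smul, norm_inv, Real.norm_natCast, smul_eq_mul]
  gcongr
  exact norm_sum_le _ _

lemma avg_le_avg (n : ℕ) {x y : ℕ → ℝ} (h : ∀ i, x i ≤ y i) : avg n x ≤ avg n y := by
  simp only [avg, smul_eq_mul]
  gcongr with i
  exact h i

lemma avg_mul_const (n : ℕ) (x : ℕ → ℝ) (c : ℝ) : avg n (fun i => x i * c) = avg n x * c := by
  simp [avg, ← Finset.sum_mul, mul_assoc]

end Algebra

variable {Q : Measure V} {X : ℕ → S → V}

namespace IsIID

lemma measurePreserving (h : IsIID μ Q X) (i : ℕ) : MeasurePreserving (X i) μ Q :=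
  ⟨h.measurable i, h.law i⟩

lemma comp (h : IsIID μ Q X) {W : Type*} [MeasurableSpace W] {g : V → W} (hg : Measurable g) :
    IsIID μ (Q.map g) fun i s => g (X i s) where
  measurable i := hg.comp (h.measurable i)
  law i := by
    rw [← h.law i, Measure.map_map hg (h.measurable i)]
    rfl
  indep := h.indep.comp (fun _ => g) fun _ => hg

lemma identDistrib (h : IsIID μ Q X) (i k : ℕ) : IdentDistrib (X i) (X k) μ μ :=
  ⟨(h.measurable i).aemeasurable, (h.measurable k).aemeasurable, by rw [h.law, h.law]⟩

lemma ae_forall (h : IsIID μ Q X) {p : V → Prop} (hp : ∀ᵐ v ∂Q, p v) :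
    ∀ᵐ s ∂μ, ∀ i, p (X i s) :=
  ae_all_iff.2 fun i => (h.measurePreserving i).quasiMeasurePreserving.ae hp

/-- The law of large numbers. -/
lemma tendsto_avg [IsFiniteMeasure μ] (h : IsIID μ Q X) {E : Type*} [NormedAddCommGroup E]
    [NormedSpace ℝ E]
    [CompleteSpace E] [MeasurableSpace E] [BorelSpace E] {g : V → E} (hg : StronglyMeasurable g)
    (hint : Integrable g Q) {N : ℕ → ℕ} (hN : Tendsto N atTop atTop) :
    Tendsto (fun p : ℕ × S => avg (N p.1) fun i => g (X i p.2)) (whp μ) (𝓝 (∫ v, g v ∂Q)) := by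
  have hi : Integrable (fun s => g (X 0 s)) μ :=
    (h.measurePreserving 0).integrable_comp_of_integrable hint
  have hind : Pairwise fun i k => IndepFun (fun s => g (X i s)) (fun s => g (X k s)) μ :=
    fun i k hik => (h.indep.indepFun hik).comp hg.measurable hg.measurable
  have hid : ∀ i, IdentDistrib (fun s => g (X i s)) (fun s => g (X 0 s)) μ μ :=
    fun i => (h.identDistrib i 0).comp hg.measurable
  have h1 := strong_law_ae (fun i s => g (X i s)) hi hind hid
  have h2 : ∫ s, g (X 0 s) ∂μ = ∫ v, g v ∂Q := by
    rw [← h.law 0, integral_map (h.measurable 0).aemeasurable hg.aestronglyMeasurable]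
  rw [h2] at h1
  have hm : ∀ n, AEStronglyMeasurable (fun s => avg n fun i => g (X i s)) μ := fun n => by
    have : AEStronglyMeasurable (fun s => ∑ i ∈ Finset.range n, g (X i s)) μ :=
      Finset.aestronglyMeasurable_fun_sum _ fun i _ =>
        (hg.comp_measurable (h.measurable i)).aestronglyMeasurable
    exact this.const_smul _
  have h3 : TendstoInMeasure μ (fun n s => avg n fun i => g (X i s)) atTop
      fun _ => ∫ v, g v ∂Q := tendstoInMeasure_of_tendsto_ae hm h1
  have h4 : TendstoInMeasure μ (fun n s => avg (N n) fun i => g (X i s)) atTop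
      fun _ => ∫ v, g v ∂Q := h3.comp hN
  have h5 := (tendsto_whp_iff_tendstoInMeasure (E := E)
    (X := fun n s => avg (N n) fun i => g (X i s)) (c := ∫ v, g v ∂Q)).2 h4
  exact h5

/-- Normalized means of centered square integrable real variables are bounded in probability. -/
lemma bddInProb_real [IsProbabilityMeasure μ] (h : IsIID μ Q X) {g : V → ℝ} (hg : Measurable g)
    (hL : MemLp g 2 Q) (h0 : ∫ v, g v ∂Q = 0) :
    BddInProb μ fun n s => √n * avg n fun i => g (X i s) := by
  have hmem : ∀ i, MemLp (fun s => g (X i s)) 2 μ := fun i =>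
    hL.comp_measurePreserving (h.measurePreserving i)
  have hvar : ∀ i, Var[fun s => g (X i s); μ] = Var[g; Q] := fun i => by
    rw [← h.law i, variance_map hg.aemeasurable (h.measurable i).aemeasurable]
    rfl
  have hmean : ∀ i, ∫ s, g (X i s) ∂μ = 0 := fun i => by
    rw [← h0, ← h.law i,
      integral_map (h.measurable i).aemeasurable hg.aestronglyMeasurable]
  have hsum : ∀ n : ℕ, MemLp (fun s => √n * avg n fun i => g (X i s)) 2 μ := fun n => by
    simp only [avg, smul_eq_mul]
    exact ((memLp_finsetSum _ fun i _ => hmem i).const_mul _).const_mul _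
  have hm : ∀ n : ℕ, ∫ s, √n * avg n (fun i => g (X i s)) ∂μ = 0 := fun n => by
    simp only [avg, smul_eq_mul, integral_const_mul]
    rw [integral_finsetSum _ fun i _ => (hmem i).integrable (by norm_num)]
    simp [hmean]
  -- For `n > 0` this is an equality, by pairwise independence; the term `n = 0` vanishes
  -- identically.
  have hv : ∀ n : ℕ, Var[fun s => √n * avg n (fun i => g (X i s)); μ] ≤ Var[g; Q] := fun n => by
    rcases Nat.eq_zero_or_pos n with rfl | hn
    · have : (fun s => √((0 : ℕ) : ℝ) * avg 0 fun i => g (X i s)) = 0 := by ext; simp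
      rw [this, variance_zero]
      exact variance_nonneg g Q
    simp only [avg, smul_eq_mul, variance_const_mul]
    have := IndepFun.variance_sum (X := fun i s => g (X i s)) (s := Finset.range n) (μ := μ)
      (fun i _ => hmem i)
      (fun i _ k _ hik => (h.indep.indepFun hik).comp hg hg)
    have h2 : (fun s => ∑ i ∈ Finset.range n, g (X i s))
        = ∑ i ∈ Finset.range n, fun s => g (X i s) := by ext; simp
    rw [h2, this]
    simp only [hvar, Finset.sum_const, Finset.card_range, nsmul_eq_mul]
    have hn' : (0 : ℝ) < n := by exact_mod_cast hn
    rw [Real.sq_sqrt hn'.le]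
    apply le_of_eq
    field_simp
  intro ε hε
  rcases eq_or_ne ε ⊤ with rfl | hεt
  · exact ⟨0, by simp⟩
  have hε' : 0 < ε.toReal := ENNReal.toReal_pos hε.ne' hεt
  -- Chebyshev's inequality needs `Var[g; Q] / M ^ 2 ≤ ε`; the added 1 keeps `M` positive when the
  -- variance is zero.
  set M := √(Var[g; Q] / ε.toReal) + 1 with hM
  have hMpos : 0 < M := by positivity
  refine ⟨M, Eventually.of_forall fun n => ?_⟩
  have h1 := meas_ge_le_variance_div_sq (hsum n) hMpos
  rw [hm] at h1
  simp only [sub_zero] at h1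
  calc μ {s | M < ‖√n * avg n fun i => g (X i s)‖}
      ≤ μ {s | M ≤ |√n * avg n fun i => g (X i s)|} := measure_mono fun s hs =>
        le_of_lt (Set.mem_ofPred.1 hs)
    _ ≤ _ := h1
    _ ≤ ENNReal.ofReal ε.toReal := by
        refine ENNReal.ofReal_le_ofReal ?_
        rw [div_le_iff₀ (by positivity)]
        have h3 : Var[g; Q] / ε.toReal ≤ M ^ 2 := by
          have h4 : 0 ≤ Var[g; Q] / ε.toReal := div_nonneg (variance_nonneg _ _) hε'.le
          rw [← Real.sq_sqrt h4]
          gcongr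
          linarith
        rw [div_le_iff₀ hε'] at h3
        linarith [hv n]
    _ = ε := ENNReal.ofReal_toReal hεt

/-- Normalized means of centered square integrable vectors are bounded in probability. -/
lemma bddInProb [IsProbabilityMeasure μ] (h : IsIID μ Q X) {q : ℕ}
    {g : V → EuclideanSpace ℝ (Fin q)} (hg : Measurable g)
    (hL : MemLp g 2 Q) (h0 : ∫ v, g v ∂Q = 0) :
    BddInProb μ fun n s => √n • avg n fun i => g (X i s) := by
  have : IsProbabilityMeasure Q := by
    rw [← h.law 0]
    exact Measure.isProbabilityMeasure_map (h.measurable 0).aemeasurable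
  refine BddInProb.of_apply fun k => ?_
  have h1 := h.bddInProb_real (g := fun v => g v k) (by fun_prop)
    (hL.continuousLinearMap_comp (EuclideanSpace.proj (𝕜 := ℝ) k)) (by
      have := (EuclideanSpace.proj (𝕜 := ℝ) k).integral_comp_comm (hL.integrable (by norm_num))
      simpa [h0] using this)
  have h2 : ∀ (n : ℕ) s, (√n • avg n fun i => g (X i s)) k
      = √n * avg n fun i => g (X i s) k := fun n s => by
    rw [PiLp.smul_apply, smul_eq_mul]
    congr 1
    exact map_avg (EuclideanSpace.proj (𝕜 := ℝ) k) n _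
  simpa only [h2] using h1

end IsIID

end Averages

/-! ### Linearization error of a random `C¹` map, controlled in mean. -/

section LinearizationModulus

variable {V : Type*} [MeasurableSpace V] {q : ℕ}

/-- A random map is almost surely `C¹` on the ball `B(θ₀, r)`, with dominated derivatives. -/
def DominatedC1 (Q : Measure V) (g : V → EuclideanSpace ℝ (Fin q) → EuclideanSpace ℝ (Fin q))
    (θ₀ : EuclideanSpace ℝ (Fin q)) (r : ℝ) : Prop :=
  (∀ᵐ v ∂Q, ContDiffOn ℝ 1 (g v) (Metric.ball θ₀ r)) ∧
    ∃ h : V → ℝ, Integrable h Q ∧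
      ∀ᵐ v ∂Q, ∀ θ ∈ Metric.ball θ₀ r, ‖fderiv ℝ (g v) θ‖ ≤ h v

variable {Q : Measure V} {g : V → EuclideanSpace ℝ (Fin q) → EuclideanSpace ℝ (Fin q)}
  {θ₀ : EuclideanSpace ℝ (Fin q)} {r : ℝ}

/-- Measurability of an operator-valued map reduces through this to its columns. -/
lemma euclidean_clm_eq_sum_smulRight
    (T : EuclideanSpace ℝ (Fin q) →L[ℝ] EuclideanSpace ℝ (Fin q)) :
    T = ∑ j, ContinuousLinearMap.smulRightL ℝ _ _ (EuclideanSpace.proj (𝕜 := ℝ) j)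
      (T (EuclideanSpace.single j 1)) := by
  refine ContinuousLinearMap.coe_injective ((EuclideanSpace.basisFun (Fin q) ℝ).toBasis.ext ?_)
  intro i
  simp

/-- Each column of the derivative is an almost sure limit of difference quotients, which are
measurable because `g` is measurable in `v` at every fixed point of the ball. The measurable version
`G` is what the law of large numbers is applied to. -/
lemma DominatedC1.exists_fderiv (h : DominatedC1 Q g θ₀ r) (hr : 0 < r)
    (hmeas : ∀ θ ∈ Metric.ball θ₀ r, Measurable fun v => g v θ) :
    ∃ G : V → EuclideanSpace ℝ (Fin q) →L[ℝ] EuclideanSpace ℝ (Fin q),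
      StronglyMeasurable G ∧ Integrable G Q ∧ G =ᵐ[Q] fun v => fderiv ℝ (g v) θ₀ := by
  obtain ⟨hC, b, hb, hbound⟩ := h
  have hdiff : ∀ᵐ v ∂Q, DifferentiableAt ℝ (g v) θ₀ := by
    filter_upwards [hC] with v hv
    exact (hv.contDiffAt (Metric.ball_mem_nhds _ hr)).differentiableAt (by norm_num)
  have hcol : ∀ j, AEMeasurable (fun v => fderiv ℝ (g v) θ₀ (EuclideanSpace.single j 1)) Q := by
    intro j
    -- The factor `2 / r` keeps the increments `(c m)⁻¹ ≤ r / 2` inside the ball already at `m = 0`.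
    set c : ℕ → ℝ := fun m => ((m : ℝ) + 1) * (2 / r) with hc
    have hcpos : ∀ m, 0 < c m := fun m => by positivity
    have hclim : Tendsto c atTop atTop :=
      (tendsto_atTop_add_const_right _ _ tendsto_natCast_atTop_atTop).atTop_mul_const
        (by positivity)
    have hmem : ∀ m, θ₀ + (c m)⁻¹ • EuclideanSpace.single j (1 : ℝ) ∈ Metric.ball θ₀ r := by
      intro m
      rw [Metric.mem_ball, dist_eq_norm, add_sub_cancel_left, norm_smul, norm_inv,
        Real.norm_of_nonneg (hcpos m).le, PiLp.norm_single, norm_one, mul_one,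
        inv_lt_comm₀ (hcpos m) hr]
      have : (0 : ℝ) ≤ m := Nat.cast_nonneg m
      calc r⁻¹ < 2 / r := by
            rw [inv_eq_one_div]
            gcongr
            norm_num
        _ ≤ c m := le_mul_of_one_le_left (by positivity) (by linarith)
    refine aemeasurable_of_tendsto_metrizable_ae atTop
      (f := fun m v => c m • (g v (θ₀ + (c m)⁻¹ • EuclideanSpace.single j (1 : ℝ)) - g v θ₀))
      (fun m => ?_) ?_
    · exact (((hmeas _ (hmem m)).sub (hmeas _ (Metric.mem_ball_self hr))).const_smul (c m)).aemeasurable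
    · filter_upwards [hdiff] with v hv
      exact (hv.hasFDerivAt.lim_real _).comp hclim
  have hG : AEStronglyMeasurable (fun v => fderiv ℝ (g v) θ₀) Q := by
    rw [funext fun v => euclidean_clm_eq_sum_smulRight (fderiv ℝ (g v) θ₀)]
    refine Finset.aestronglyMeasurable_fun_sum _ fun j _ => ?_
    exact (ContinuousLinearMap.continuous _).comp_aestronglyMeasurable
      (hcol j).aestronglyMeasurable
  have hint : Integrable (fun v => fderiv ℝ (g v) θ₀) Q := by
    refine hb.mono' hG ?_
    filter_upwards [hbound] with v hv using hv θ₀ (Metric.mem_ball_self hr)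
  exact ⟨hG.mk _, hG.stronglyMeasurable_mk, hint.congr hG.ae_eq_mk, hG.ae_eq_mk.symm⟩

open Classical in
/-- The best constant, over a countable dense subset of `B(θ₀, δ)`, in the approximation of the
increments of `f` by the linear map `T`. -/
noncomputable def linModulus (f : EuclideanSpace ℝ (Fin q) → EuclideanSpace ℝ (Fin q))
    (T : EuclideanSpace ℝ (Fin q) →L[ℝ] EuclideanSpace ℝ (Fin q))
    (θ₀ : EuclideanSpace ℝ (Fin q)) (δ : ℝ) : ENNReal :=
  ⨆ (m : ℕ) (l : ℕ),
    if TopologicalSpace.denseSeq (EuclideanSpace ℝ (Fin q)) m ∈ Metric.ball θ₀ δ ∧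
      TopologicalSpace.denseSeq (EuclideanSpace ℝ (Fin q)) l ∈ Metric.ball θ₀ δ then
      ‖f (TopologicalSpace.denseSeq _ m) - f (TopologicalSpace.denseSeq _ l)
        - T (TopologicalSpace.denseSeq _ m - TopologicalSpace.denseSeq _ l)‖ₑ
        / ‖TopologicalSpace.denseSeq (EuclideanSpace ℝ (Fin q)) m
            - TopologicalSpace.denseSeq _ l‖ₑ
    else 0

section Deterministic

variable {f : EuclideanSpace ℝ (Fin q) → EuclideanSpace ℝ (Fin q)}
    {T : EuclideanSpace ℝ (Fin q) →L[ℝ] EuclideanSpace ℝ (Fin q)} {δ : ℝ}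

lemma linModulus_le {C : ℝ} (hC : 0 ≤ C)
    (h : ∀ x ∈ Metric.ball θ₀ δ, ∀ y ∈ Metric.ball θ₀ δ, ‖f x - f y - T (x - y)‖ ≤ C * ‖x - y‖) :
    linModulus f T θ₀ δ ≤ ENNReal.ofReal C := by
  refine iSup₂_le fun m l => ?_
  split_ifs with hml
  · refine ENNReal.div_le_of_le_mul ?_
    have := h _ hml.1 _ hml.2
    rw [← ofReal_norm, ← ofReal_norm, ← ENNReal.ofReal_mul hC]
    exact ENNReal.ofReal_le_ofReal this
  · exact zero_le

/-- The bound holds on pairs from the dense sequence and extends to all pairs by continuity of both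
sides. -/
lemma norm_sub_sub_le_linModulus (hf : ContinuousOn f (Metric.ball θ₀ δ))
    (hfin : linModulus f T θ₀ δ ≠ ⊤) {x y : EuclideanSpace ℝ (Fin q)}
    (hx : x ∈ Metric.ball θ₀ δ) (hy : y ∈ Metric.ball θ₀ δ) :
    ‖f x - f y - T (x - y)‖ ≤ (linModulus f T θ₀ δ).toReal * ‖x - y‖ := by
  set D := Set.range (TopologicalSpace.denseSeq (EuclideanSpace ℝ (Fin q)))
  have hD : Dense D := TopologicalSpace.denseRange_denseSeq _
  set s := (Metric.ball θ₀ δ ∩ D) ×ˢ (Metric.ball θ₀ δ ∩ D)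
  have hcl : (x, y) ∈ closure s := by
    rw [closure_prod_eq]
    exact ⟨hD.open_subset_closure_inter Metric.isOpen_ball hx,
      hD.open_subset_closure_inter Metric.isOpen_ball hy⟩
  have hxy : ∀ z ∈ Metric.ball θ₀ δ, ContinuousAt f z := fun z hz =>
    hf.continuousAt (Metric.isOpen_ball.mem_nhds hz)
  have h1 : ContinuousAt (fun p : EuclideanSpace ℝ (Fin q) × EuclideanSpace ℝ (Fin q) =>
      ‖f p.1 - f p.2 - T (p.1 - p.2)‖) (x, y) := by
    have h2 : ContinuousAt (fun p : EuclideanSpace ℝ (Fin q) × EuclideanSpace ℝ (Fin q) => f p.1)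
        (x, y) := ContinuousAt.comp (f := Prod.fst) (hxy x hx) continuousAt_fst
    have h3 : ContinuousAt (fun p : EuclideanSpace ℝ (Fin q) × EuclideanSpace ℝ (Fin q) => f p.2)
        (x, y) := ContinuousAt.comp (f := Prod.snd) (hxy y hy) continuousAt_snd
    exact ((h2.sub h3).sub (by fun_prop)).norm
  refine ContinuousWithinAt.closure_le hcl h1.continuousWithinAt
    (g := fun p : EuclideanSpace ℝ (Fin q) × EuclideanSpace ℝ (Fin q) =>
      (linModulus f T θ₀ δ).toReal * ‖p.1 - p.2‖)
    (Continuous.continuousWithinAt (by fun_prop)) ?_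
  rintro ⟨a, b⟩ ⟨⟨ha, m, rfl⟩, hb, l, rfl⟩
  have h4 : _ ≤ linModulus f T θ₀ δ := le_iSup₂_of_le m l le_rfl
  rw [if_pos ⟨ha, hb⟩] at h4
  simp only at h4 ⊢
  set a := TopologicalSpace.denseSeq (EuclideanSpace ℝ (Fin q)) m
  set b := TopologicalSpace.denseSeq (EuclideanSpace ℝ (Fin q)) l
  by_cases hab : a = b
  · simp [hab]
  have hne : ‖a - b‖ₑ ≠ 0 := by simpa [sub_eq_zero] using hab
  have h5 : ‖f a - f b - T (a - b)‖ₑ ≤ linModulus f T θ₀ δ * ‖a - b‖ₑ := by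
    rwa [ENNReal.div_le_iff hne (by simp)] at h4
  have h6 := ENNReal.toReal_mono (ENNReal.mul_ne_top hfin (by simp)) h5
  simpa [ENNReal.toReal_mul] using h6

end Deterministic

/-- The supremum is countable, so measurability at each fixed parameter suffices; this is the reason
for restricting to a dense sequence. -/
lemma measurable_linModulus
    {G : V → EuclideanSpace ℝ (Fin q) →L[ℝ] EuclideanSpace ℝ (Fin q)} (hG : Measurable G) {δ : ℝ}
    (hmeas : ∀ θ ∈ Metric.ball θ₀ δ, Measurable fun v => g v θ) :
    Measurable fun v => linModulus (g v) (G v) θ₀ δ := by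
  refine Measurable.iSup fun m => Measurable.iSup fun l => ?_
  split_ifs with hml
  · have h1 := hG.apply_continuousLinearMap
      (TopologicalSpace.denseSeq (EuclideanSpace ℝ (Fin q)) m - TopologicalSpace.denseSeq _ l)
    exact (((hmeas _ hml.1).sub (hmeas _ hml.2)).sub h1).enorm.div_const _
  · exact measurable_const

/-- A random map with dominated derivatives is uniformly close, in mean, to its linearization. -/
lemma DominatedC1.exists_linearization (h : DominatedC1 Q g θ₀ r) (hr : 0 < r)
    (hmeas : ∀ θ ∈ Metric.ball θ₀ r, Measurable fun v => g v θ)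
    {G : V → EuclideanSpace ℝ (Fin q) →L[ℝ] EuclideanSpace ℝ (Fin q)}
    (hG : StronglyMeasurable G) (hGf : G =ᵐ[Q] fun v => fderiv ℝ (g v) θ₀) {ε : ℝ} (hε : 0 < ε) :
    ∃ δ > 0, δ ≤ r ∧ ∃ k : V → ℝ, StronglyMeasurable k ∧ (∀ v, 0 ≤ k v) ∧ Integrable k Q ∧
      ∫ v, k v ∂Q ≤ ε ∧ ∀ᵐ v ∂Q, ∀ x ∈ Metric.ball θ₀ δ, ∀ y ∈ Metric.ball θ₀ δ,
        ‖g v x - g v y - G v (x - y)‖ ≤ k v * ‖x - y‖ := by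
  obtain ⟨hC, b, hb, hbound⟩ := h
  set δ : ℕ → ℝ := fun m => r / ((m : ℝ) + 1) with hδ
  have hδpos : ∀ m, 0 < δ m := fun m => by positivity
  have hδr : ∀ m, δ m ≤ r := fun m => div_le_self hr.le (by simp)
  have hδ0 : Tendsto δ atTop (𝓝 0) :=
    (tendsto_const_nhds (x := r)).div_atTop
      (tendsto_atTop_add_const_right _ _ tendsto_natCast_atTop_atTop)
  have hsub : ∀ m, Metric.ball θ₀ (δ m) ⊆ Metric.ball θ₀ r := fun m =>
    Metric.ball_subset_ball (hδr m)
  have hKmeas : ∀ m, Measurable fun v => linModulus (g v) (G v) θ₀ (δ m) := fun m =>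
    measurable_linModulus hG.measurable fun θ hθ => hmeas θ (hsub m hθ)
  -- Mean value inequality: the derivative differs from its value at `θ₀` by at most `2 * b v` on
  -- the ball.
  have hKb : ∀ m, ∀ᵐ v ∂Q, linModulus (g v) (G v) θ₀ (δ m) ≤ ENNReal.ofReal (2 * b v) := by
    intro m
    filter_upwards [hC, hbound, hGf] with v hv hbv hGv
    have hb0 : 0 ≤ b v := (norm_nonneg _).trans (hbv θ₀ (Metric.mem_ball_self hr))
    refine linModulus_le (by positivity) fun x hx y hy => ?_
    refine (convex_ball θ₀ r).norm_image_sub_le_of_norm_fderiv_le' (𝕜 := ℝ) (fun z hz => ?_)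
      (fun z hz => ?_) (hsub m hy) (hsub m hx)
    · exact (hv.contDiffAt (Metric.isOpen_ball.mem_nhds hz)).differentiableAt (by norm_num)
    · rw [hGv]
      refine (norm_sub_le _ _).trans ?_
      linarith [hbv z hz, hbv θ₀ (Metric.mem_ball_self hr)]
  -- A `C¹` map is strictly differentiable, which says precisely that this modulus vanishes as the
  -- ball shrinks. Dominated convergence then makes its mean small for some `m`.
  have hKlim : ∀ᵐ v ∂Q, Tendsto (fun m => linModulus (g v) (G v) θ₀ (δ m)) atTop (𝓝 0) := by
    filter_upwards [hC, hGf] with v hv hGv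
    have hs : HasStrictFDerivAt (g v) (G v) θ₀ := by
      rw [hGv]
      exact (hv.contDiffAt (Metric.ball_mem_nhds _ hr)).hasStrictFDerivAt (by norm_num)
    rw [ENNReal.tendsto_nhds_zero]
    intro c hc
    obtain ⟨c', hc'0, hc'⟩ : ∃ c' : NNReal, 0 < c' ∧ (c' : ENNReal) ≤ c := by
      obtain ⟨c', h1, h2⟩ := ENNReal.lt_iff_exists_nnreal_btwn.1 hc
      exact ⟨c', by exact_mod_cast h1, h2.le⟩
    obtain ⟨s, hs, hsa⟩ := hs.approximates_deriv_on_nhds (c := c') (Or.inr hc'0)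
    obtain ⟨ρ, hρ, hρs⟩ := Metric.mem_nhds_iff.1 hs
    filter_upwards [hδ0.eventually_lt_const hρ] with m hm
    have hms : Metric.ball θ₀ (δ m) ⊆ s := (Metric.ball_subset_ball hm.le).trans hρs
    refine le_trans (linModulus_le c'.2 fun x hx y hy => hsa x (hms hx) y (hms hy)) ?_
    simpa using hc'
  have hlim := tendsto_lintegral_of_dominated_convergence (μ := Q)
    (F := fun m v => linModulus (g v) (G v) θ₀ (δ m)) (f := fun _ => 0)
    (fun v => ENNReal.ofReal (2 * b v)) hKmeas hKb (hb.const_mul 2).lintegral_lt_top.ne hKlim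
  rw [lintegral_zero] at hlim
  obtain ⟨m, hm⟩ := (hlim.eventually_lt_const (ENNReal.ofReal_pos.2 hε)).exists
  have hfin : ∀ᵐ v ∂Q, linModulus (g v) (G v) θ₀ (δ m) < ⊤ :=
    ae_lt_top (hKmeas m) (hm.trans ENNReal.ofReal_lt_top).ne
  refine ⟨δ m, hδpos m, hδr m, fun v => (linModulus (g v) (G v) θ₀ (δ m)).toReal,
    (hKmeas m).ennreal_toReal.stronglyMeasurable, fun v => ENNReal.toReal_nonneg,
    integrable_toReal_of_lintegral_ne_top (hKmeas m).aemeasurable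
      (hm.trans ENNReal.ofReal_lt_top).ne, ?_, ?_⟩
  · rw [integral_toReal (hKmeas m).aemeasurable hfin]
    exact ENNReal.toReal_le_of_le_ofReal hε.le hm.le
  · filter_upwards [hC, hfin] with v hv hvf x hx y hy
    exact norm_sub_sub_le_linModulus (hv.continuousOn.mono (hsub m)) hvf.ne hx hy

end LinearizationModulus

/-! ### Transfer of almost sure domination to the law of the unlabeled data. -/

section Marginal

variable {V W : Type*} [MeasurableSpace V] [StandardBorelSpace V] [Nonempty V]
  [MeasurableSpace W] {P : Measure (V × W)} [IsFiniteMeasure P]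

/-- Disintegration of `P` over its second marginal. The coordinates are swapped because only the
first factor, later the outcome in `ℝ`, is assumed standard Borel. -/
lemma ae_map_snd_ae_condKernel {p : V × W → Prop} (h : ∀ᵐ o ∂P, p o) :
    ∀ᵐ w ∂P.map Prod.snd, ∀ᵐ v ∂(P.map Prod.swap).condKernel w, p (v, w) := by
  have h1 : ∀ᵐ x ∂(P.map Prod.swap), p x.swap :=
    (MeasurableEquiv.prodComm (α := V) (β := W)).measurableEmbedding.ae_map_iff.2 h
  rw [← (P.map Prod.swap).disintegrate (P.map Prod.swap).condKernel] at h1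
  have h2 := Measure.ae_ae_of_ae_compProd h1
  rw [Measure.fst_map_swap] at h2
  exact h2

/-- A function on the second factor which is almost surely bounded by an integrable function on
the product is almost surely bounded by an integrable function for the marginal measure. -/
lemma exists_integrable_map_snd_bound {h : V × W → ℝ} (hh : Integrable h P) :
    ∃ h' : W → ℝ, Integrable h' (P.map Prod.snd) ∧ ∀ φ : W → Set ℝ,
      (∀ᵐ o ∂P, ∀ x ∈ φ o.2, x ≤ h o) → ∀ᵐ w ∂P.map Prod.snd, ∀ x ∈ φ w, x ≤ h' w := by
  set κ := (P.map Prod.swap).condKernel with hκ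
  have hint : Integrable (fun x : W × V => h x.swap) (P.map Prod.swap) :=
    (MeasurableEquiv.prodComm (α := V) (β := W)).measurableEmbedding.integrable_map_iff.2 hh
  rw [← (P.map Prod.swap).disintegrate κ, Measure.fst_map_swap] at hint
  have hi1 := ((Measure.integrable_compProd_iff hint.aestronglyMeasurable).1 hint)
  -- The conditional mean of `|h|` given the second factor is the new bound: a number bounded by `h
  -- (v, w)` for almost every `v` is bounded by the mean.
  refine ⟨fun w => ∫ v, ‖h (v, w)‖ ∂κ w, hi1.2, fun φ hφ => ?_⟩
  filter_upwards [hi1.1, ae_map_snd_ae_condKernel hφ] with w hw hφw x hx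
  calc x = ∫ _, x ∂κ w := by simp
    _ ≤ ∫ v, ‖h (v, w)‖ ∂κ w := by
      refine integral_mono_ae (integrable_const _) hw.norm ?_
      filter_upwards [hφw] with v hv using (hv x hx).trans (le_abs_self _)

/-- Domination for a random map that depends on the second factor only. -/
lemma DominatedC1.map_snd {q : ℕ}
    {g : W → EuclideanSpace ℝ (Fin q) → EuclideanSpace ℝ (Fin q)}
    {θ₀ : EuclideanSpace ℝ (Fin q)} {r : ℝ} (h : DominatedC1 P (fun o => g o.2) θ₀ r) :
    DominatedC1 (P.map Prod.snd) g θ₀ r := by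
  obtain ⟨hC, b, hb, hbound⟩ := h
  obtain ⟨b', hb', H⟩ := exists_integrable_map_snd_bound hb
  refine ⟨?_, b', hb', ?_⟩
  · filter_upwards [ae_map_snd_ae_condKernel hC] with w hw
    -- The property does not involve the first factor, and a conditional probability law has a point
    -- where an almost sure property holds.
    exact hw.exists.choose_spec
  -- Passing the set of derivative norms, rather than its supremum, avoids any measurability
  -- question about the supremum over the ball.
  · have := H (fun w => (fun θ => ‖fderiv ℝ (g w) θ‖) '' Metric.ball θ₀ r) (by
      filter_upwards [hbound] with o ho x hx
      obtain ⟨θ, hθ, rfl⟩ := hx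
      exact ho θ hθ)
    filter_upwards [this] with w hw θ hθ using hw _ ⟨θ, hθ, rfl⟩

end Marginal

/-! ### Diagonal weights as linear maps. -/

section DiagMul

variable {q : ℕ}

/-- `diag(w)` as a continuous linear map. -/
noncomputable def diagMulL (w : EuclideanSpace ℝ (Fin q)) :
    EuclideanSpace ℝ (Fin q) →L[ℝ] EuclideanSpace ℝ (Fin q) :=
  LinearMap.toContinuousLinearMap
    { toFun := diagMul w
      map_add' := fun x y => by ext k; simp [diagMul, mul_add]
      map_smul' := fun c x => by ext k; simp [diagMul, mul_left_comm] }

@[simp]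
lemma diagMulL_apply (w v : EuclideanSpace ℝ (Fin q)) : diagMulL w v = diagMul w v := rfl

lemma diagMul_sub_left (w w' v : EuclideanSpace ℝ (Fin q)) :
    diagMul (w - w') v = diagMul w v - diagMul w' v := by
  ext k
  simp [diagMul, sub_mul]

lemma norm_diagMul_le (w v : EuclideanSpace ℝ (Fin q)) : ‖diagMul w v‖ ≤ ‖w‖ * ‖v‖ := by
  rw [EuclideanSpace.norm_eq (diagMul w v), EuclideanSpace.norm_eq v,
    ← Real.sqrt_sq (norm_nonneg w), ← Real.sqrt_mul (sq_nonneg _), Finset.mul_sum]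
  refine Real.sqrt_le_sqrt (Finset.sum_le_sum fun k _ => ?_)
  simp only [diagMul, norm_mul, mul_pow]
  gcongr
  exact PiLp.norm_apply_le w k

end DiagMul

/-! ### Deterministic bounds on the increments of the sample estimating function. -/

section SampleIncrements

variable {q : ℕ}

local notation "E" => EuclideanSpace ℝ (Fin q)

lemma norm_avg_increment_le {ι : Type*} {δ : ℝ} {θ₀ : E} (n : ℕ) (X : ℕ → ι) {g : ι → E → E}
    {G : ι → E →L[ℝ] E} {k : ι → ℝ}
    (h : ∀ i, ∀ x ∈ Metric.ball θ₀ δ, ∀ y ∈ Metric.ball θ₀ δ,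
      ‖g (X i) x - g (X i) y - G (X i) (x - y)‖ ≤ k (X i) * ‖x - y‖)
    {x y : E} (hx : x ∈ Metric.ball θ₀ δ) (hy : y ∈ Metric.ball θ₀ δ) :
    ‖avg n (fun i => g (X i) x) - avg n (fun i => g (X i) y) - avg n (fun i => G (X i)) (x - y)‖
      ≤ avg n (fun i => k (X i)) * ‖x - y‖ := by
  have h1 : avg n (fun i => G (X i)) (x - y) = avg n fun i => G (X i) (x - y) :=
    map_avg (ContinuousLinearMap.apply ℝ E (x - y)) n fun i => G (X i)
  rw [h1, ← avg_sub, ← avg_sub, ← avg_mul_const]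
  exact (norm_avg_le _ _).trans (avg_le_avg _ fun i => h i x hx y hy)

variable {d : ℕ} {Z : Type*}

lemma pspaFun_eq (ψ : EstFun d q) (f : Z → ℝ) (n N : ℕ) (L : ℕ → Obs d Z) (U : ℕ → UnlabObs d Z)
    (w θ : E) : pspaFun ψ f n N L U w θ = avg n (fun i => psiY ψ θ (L i))
      + diagMulL w (avg N (fun i => psiF ψ f θ (U i)) - avg n fun i => psiF ψ f θ (L i).2) := by
  rw [sub_eq_neg_add]
  rfl

/-- The increment error splits into averaged linearization errors, the deviation of the averaged
`GY` from `A`, and the difference of the two averages of `GF`. The last one enters only as a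
difference, so no derivative of the prediction part appears in `A`. -/
lemma approximatesLinearOn_pspaFun_of_le {ψ : EstFun d q} {f : Z → ℝ} {n N : ℕ}
    {L : ℕ → Obs d Z} {U : ℕ → UnlabObs d Z} {w θ₀ : E} {δ : ℝ} {A : E →L[ℝ] E}
    {GY : Obs d Z → E →L[ℝ] E} {kY : Obs d Z → ℝ}
    {GF : UnlabObs d Z → E →L[ℝ] E} {kF : UnlabObs d Z → ℝ}
    (hY : ∀ i, ∀ x ∈ Metric.ball θ₀ δ, ∀ y ∈ Metric.ball θ₀ δ,
      ‖psiY ψ x (L i) - psiY ψ y (L i) - GY (L i) (x - y)‖ ≤ kY (L i) * ‖x - y‖)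
    (hL : ∀ i, ∀ x ∈ Metric.ball θ₀ δ, ∀ y ∈ Metric.ball θ₀ δ,
      ‖psiF ψ f x (L i).2 - psiF ψ f y (L i).2 - GF (L i).2 (x - y)‖ ≤ kF (L i).2 * ‖x - y‖)
    (hU : ∀ i, ∀ x ∈ Metric.ball θ₀ δ, ∀ y ∈ Metric.ball θ₀ δ,
      ‖psiF ψ f x (U i) - psiF ψ f y (U i) - GF (U i) (x - y)‖ ≤ kF (U i) * ‖x - y‖)
    {c : NNReal} (hc : avg n (fun i => kY (L i)) + ‖avg n (fun i => GY (L i)) - A‖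
      + ‖w‖ * (avg N (fun i => kF (U i)) + avg n (fun i => kF (L i).2)
        + ‖avg N (fun i => GF (U i)) - avg n (fun i => GF (L i).2)‖) ≤ c) :
    ApproximatesLinearOn (pspaFun ψ f n N L U w) A (Metric.ball θ₀ δ) c := by
  intro x hx y hy
  have h1 := norm_avg_increment_le (g := fun o θ => psiY ψ θ o) n L hY hx hy
  have h2 := norm_avg_increment_le (g := fun u θ => psiF ψ f θ u) n (fun i => (L i).2) hL hx hy
  have h3 := norm_avg_increment_le (g := fun u θ => psiF ψ f θ u) N U hU hx hy
  have h4 := (avg n (fun i => GY (L i)) - A).le_opNorm (x - y)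
  have h5 := (avg N (fun i => GF (U i)) - avg n (fun i => GF (L i).2)).le_opNorm (x - y)
  rw [pspaFun_eq, pspaFun_eq]
  set aY := avg n (fun i => psiY ψ x (L i)) - avg n (fun i => psiY ψ y (L i))
    - avg n (fun i => GY (L i)) (x - y) with haY
  set aL := avg n (fun i => psiF ψ f x (L i).2) - avg n (fun i => psiF ψ f y (L i).2)
    - avg n (fun i => GF (L i).2) (x - y) with haL
  set aU := avg N (fun i => psiF ψ f x (U i)) - avg N (fun i => psiF ψ f y (U i))
    - avg N (fun i => GF (U i)) (x - y) with haU
  set bY := (avg n (fun i => GY (L i)) - A) (x - y) with hbY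
  set bF := (avg N (fun i => GF (U i)) - avg n (fun i => GF (L i).2)) (x - y) with hbF
  have key : avg n (fun i => psiY ψ x (L i))
      + diagMulL w (avg N (fun i => psiF ψ f x (U i)) - avg n fun i => psiF ψ f x (L i).2)
      - (avg n (fun i => psiY ψ y (L i))
      + diagMulL w (avg N (fun i => psiF ψ f y (U i)) - avg n fun i => psiF ψ f y (L i).2))
      - A (x - y) = aY + bY + diagMulL w (aU - aL + bF) := by
    have : aU - aL + bF = (avg N (fun i => psiF ψ f x (U i)) - avg n fun i => psiF ψ f x (L i).2)
        - (avg N (fun i => psiF ψ f y (U i)) - avg n fun i => psiF ψ f y (L i).2) := by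
      rw [haU, haL, hbF, _root_.sub_apply]
      abel
    rw [this, haY, hbY, _root_.sub_apply]
    simp only [map_sub]
    abel
  rw [key, diagMulL_apply]
  calc ‖aY + bY + diagMul w (aU - aL + bF)‖
      ≤ ‖aY‖ + ‖bY‖ + ‖w‖ * (‖aU‖ + ‖aL‖ + ‖bF‖) := by
        refine (norm_add₃_le).trans ?_
        gcongr
        refine (norm_diagMul_le _ _).trans ?_
        gcongr
        exact (norm_add_le _ _).trans (by gcongr; exact norm_sub_le _ _)
    _ ≤ (avg n (fun i => kY (L i)) + ‖avg n (fun i => GY (L i)) - A‖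
      + ‖w‖ * (avg N (fun i => kF (U i)) + avg n (fun i => kF (L i).2)
        + ‖avg N (fun i => GF (U i)) - avg n (fun i => GF (L i).2)‖)) * ‖x - y‖ := by
        have h6 : ‖w‖ * (‖aU‖ + ‖aL‖ + ‖bF‖) ≤ ‖w‖ * (avg N (fun i => kF (U i)) * ‖x - y‖
          + avg n (fun i => kF (L i).2) * ‖x - y‖
          + ‖avg N (fun i => GF (U i)) - avg n (fun i => GF (L i).2)‖ * ‖x - y‖) := by
          gcongr
        linarith
    _ ≤ c * ‖x - y‖ := by gcongr

end SampleIncrements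

/-! ### Uniform local linearization with high probability. -/

section Sample

variable {d q : ℕ} {Z : Type*} [MeasurableSpace Z] {P : Measure (Obs d Z)}
  {ψ : EstFun d q} {f : Z → ℝ} {Θ : Set (EuclideanSpace ℝ (Fin q))}
  {θ₀ ω : EuclideanSpace ℝ (Fin q)}
  {S : Type*} [MeasurableSpace S] {μ : Measure S}
  {L : ℕ → S → Obs d Z} {U : ℕ → S → UnlabObs d Z}

lemma IsSample.iid_labeled (h : IsSample μ P L U) : IsIID μ P L :=
  ⟨h.measurable_labeled, h.law_labeled, h.indep_labeled⟩

lemma IsSample.iid_unlabeled (h : IsSample μ P L U) : IsIID μ (P.map Prod.snd) U :=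
  ⟨h.measurable_unlabeled, h.law_unlabeled, h.indep_unlabeled⟩

lemma IsSample.iid_labeled_snd (h : IsSample μ P L U) :
    IsIID μ (P.map Prod.snd) fun i s => (L i s).2 :=
  h.iid_labeled.comp measurable_snd

namespace PopulationConditions

lemma measurable_psiY (hP : PopulationConditions P ψ f Θ θ₀ ω) {θ : EuclideanSpace ℝ (Fin q)}
    (hθ : θ ∈ Θ) : Measurable (psiY (Z := Z) ψ θ) :=
  (hP.measurable_psi θ hθ).comp
    (g := fun p : ℝ × EuclideanSpace ℝ (Fin d) => ψ p.1 p.2 θ)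
    (f := fun o : Obs d Z => (o.1, o.2.1)) (by fun_prop)

lemma measurable_psiF (hP : PopulationConditions P ψ f Θ θ₀ ω) {θ : EuclideanSpace ℝ (Fin q)}
    (hθ : θ ∈ Θ) : Measurable (psiF ψ f θ) :=
  (hP.measurable_psi θ hθ).comp
    (g := fun p : ℝ × EuclideanSpace ℝ (Fin d) => ψ p.1 p.2 θ)
    (f := fun u : UnlabObs d Z => (f u.2, u.1))
    ((hP.measurable_pred.comp measurable_snd).prodMk measurable_fst)

/-- The matrix `A` as a linear map. -/
lemma integral_fderiv_eq [IsProbabilityMeasure P]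
    {G : Obs d Z → EuclideanSpace ℝ (Fin q) →L[ℝ] EuclideanSpace ℝ (Fin q)}
    (hG : Integrable G P) (hGf : G =ᵐ[P] fun o => fderiv ℝ (ψ o.1 o.2.1) θ₀) :
    ∫ o, G o ∂P = Matrix.toEuclideanCLM (𝕜 := ℝ) (matA P ψ θ₀) := by
  refine ContinuousLinearMap.coe_injective ((EuclideanSpace.basisFun (Fin q) ℝ).toBasis.ext ?_)
  intro j
  ext i
  have h1 := (EuclideanSpace.proj (𝕜 := ℝ) i : EuclideanSpace ℝ (Fin q) →L[ℝ] ℝ).integral_comp_comm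
    (hG.apply_continuousLinearMap (EuclideanSpace.single j 1))
  have h2 := ContinuousLinearMap.integral_apply hG (EuclideanSpace.single j (1 : ℝ))
  have h3 : ∫ o, fderiv ℝ (ψ o.1 o.2.1) θ₀ (EuclideanSpace.single j 1) i ∂P
      = ∫ o, G o (EuclideanSpace.single j 1) i ∂P :=
    integral_congr_ae (by filter_upwards [hGf] with o ho; rw [ho])
  simp only [OrthonormalBasis.coe_toBasis, EuclideanSpace.basisFun_apply,
    ContinuousLinearMap.coe_coe]
  rw [h2]
  refine Eq.trans h1.symm ?_
  simp [matA, ← h3]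

/-- With high probability, the sample estimating function is close to an affine map with linear
part `A`. -/
lemma exists_approximatesLinearOn [IsProbabilityMeasure P] [IsProbabilityMeasure μ]
    (hP : PopulationConditions P ψ f Θ θ₀ ω)
    (hdata : IsSample μ P L U) {N : ℕ → ℕ} (hN : Tendsto N atTop atTop)
    {ωhat : ℕ → S → EuclideanSpace ℝ (Fin q)}
    (hω : Tendsto (fun p : ℕ × S => ωhat p.1 p.2) (whp μ) (𝓝 ω)) {c : NNReal} (hc : 0 < c) :
    ∃ δ > 0, Metric.ball θ₀ δ ⊆ Θ ∧ ∀ᶠ p : ℕ × S in whp μ,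
      ApproximatesLinearOn (pspaFun ψ f p.1 (N p.1) (fun i => L i p.2) (fun i => U i p.2)
        (ωhat p.1 p.2)) (Matrix.toEuclideanCLM (𝕜 := ℝ) (matA P ψ θ₀)) (Metric.ball θ₀ δ) c := by
  obtain ⟨r, hr, hrΘ, hY, hF⟩ := hP.smooth
  replace hY : DominatedC1 P (fun o θ => psiY ψ θ o) θ₀ r := hY
  replace hF : DominatedC1 P (fun o θ => psiF ψ f θ o.2) θ₀ r := hF
  have hF' : DominatedC1 (P.map Prod.snd) (fun u θ => psiF ψ f θ u) θ₀ r := hF.map_snd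
  have hmY : ∀ θ ∈ Metric.ball θ₀ r, Measurable fun o : Obs d Z => psiY ψ θ o :=
    fun θ hθ => hP.measurable_psiY (hrΘ hθ)
  have hmF : ∀ θ ∈ Metric.ball θ₀ r, Measurable fun u : UnlabObs d Z => psiF ψ f θ u :=
    fun θ hθ => hP.measurable_psiF (hrΘ hθ)
  obtain ⟨GY, hGY, hGYi, hGYf⟩ := hY.exists_fderiv hr hmY
  obtain ⟨GF, hGF, hGFi, hGFf⟩ := hF'.exists_fderiv hr hmF
  have hc' : (0 : ℝ) < c := hc
  -- Budget for `c`: the limit of the outcome error is at most `c / 4`, and the two prediction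
  -- errors, weighted by `‖ω‖`, together contribute at most another `c / 4`. The total `c / 2 < c`
  -- leaves room to pass from limits to samples; `‖ω‖ + 1` avoids division by zero.
  obtain ⟨δY, hδY, hδYr, kY, hkY, hkY0, hkYi, hkYε, hkYb⟩ :=
    hY.exists_linearization hr hmY hGY hGYf (ε := c / 4) (by positivity)
  obtain ⟨δF, hδF, hδFr, kF, hkF, hkF0, hkFi, hkFε, hkFb⟩ :=
    hF'.exists_linearization hr hmF hGF hGFf (ε := c / (8 * (‖ω‖ + 1))) (by positivity)
  refine ⟨min δY δF, lt_min hδY hδF,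
    (Metric.ball_subset_ball ((min_le_left _ _).trans hδYr)).trans hrΘ, ?_⟩
  have hbY := Metric.ball_subset_ball (x := θ₀) (min_le_left δY δF)
  have hbF := Metric.ball_subset_ball (x := θ₀) (min_le_right δY δF)
  have h1 := hdata.iid_labeled.tendsto_avg hkY hkYi tendsto_id
  have h2 := hdata.iid_labeled.tendsto_avg hGY hGYi tendsto_id
  have h3 := hdata.iid_unlabeled.tendsto_avg hkF hkFi hN
  have h4 := hdata.iid_labeled_snd.tendsto_avg hkF hkFi tendsto_id
  have h5 := hdata.iid_unlabeled.tendsto_avg hGF hGFi hN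
  have h6 := hdata.iid_labeled_snd.tendsto_avg hGF hGFi tendsto_id
  rw [integral_fderiv_eq (ψ := ψ) (θ₀ := θ₀) hGYi hGYf] at h2
  set A := Matrix.toEuclideanCLM (𝕜 := ℝ) (matA P ψ θ₀)
  have hlim := (h1.add (h2.sub_const A).norm).add
    (hω.norm.mul ((h3.add h4).add (h5.sub h6).norm))
  have hlt : ∫ o, kY o ∂P + ‖A - A‖ + ‖ω‖ * (∫ u, kF u ∂(P.map Prod.snd)
      + ∫ u, kF u ∂(P.map Prod.snd)
      + ‖∫ u, GF u ∂(P.map Prod.snd) - ∫ u, GF u ∂(P.map Prod.snd)‖) < c := by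
    rw [sub_self, norm_zero, sub_self, norm_zero, add_zero, add_zero]
    have h7 : ‖ω‖ * (∫ u, kF u ∂(P.map Prod.snd) + ∫ u, kF u ∂(P.map Prod.snd))
        ≤ (‖ω‖ + 1) * (c / (8 * (‖ω‖ + 1)) + c / (8 * (‖ω‖ + 1))) := by
      have h0 : 0 ≤ ∫ u, kF u ∂(P.map Prod.snd) := integral_nonneg hkF0
      gcongr
      linarith
    have h8 : (‖ω‖ + 1) * (c / (8 * (‖ω‖ + 1)) + c / (8 * (‖ω‖ + 1))) = (c : ℝ) / 4 := by
      field_simp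
      norm_num
    linarith
  have haeY := hdata.iid_labeled.ae_forall hkYb
  have haeL := hdata.iid_labeled_snd.ae_forall hkFb
  have haeU := hdata.iid_unlabeled.ae_forall hkFb
  have hae := eventually_whp_snd_of_ae (haeY.and (haeL.and haeU))
  filter_upwards [hlim.eventually_lt_const hlt, hae] with p hp hpae
  exact approximatesLinearOn_pspaFun_of_le
    (fun i x hx y hy => hpae.1 i x (hbY hx) y (hbY hy))
    (fun i x hx y hy => hpae.2.1 i x (hbF hx) y (hbF hy))
    (fun i x hx y hy => hpae.2.2 i x (hbF hx) y (hbF hy)) hp.le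

end PopulationConditions

end Sample

/-! ### Existence, consistency and expansion of the zero. -/

section ZEstimator

variable {E T : Type*} [NormedAddCommGroup E] [NormedSpace ℝ E] [CompleteSpace E] {l : Filter T}

/-- The expansion of the unique zero of a random function that is close to an affine map. -/
lemma isLittleO_zero_expansion {Ψ : T → E → E} {θhat : T → E} {Θ : Set E} {θ₀ : E} (A : E ≃L[ℝ] E)
    (hlin : ∀ c : NNReal, 0 < c → ∃ δ > 0, Metric.ball θ₀ δ ⊆ Θ ∧
      ∀ᶠ p in l, ApproximatesLinearOn (Ψ p) (A : E →L[ℝ] E) (Metric.ball θ₀ δ) c)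
    (hzero : ∀ᶠ p in l, Ψ p (θhat p) = 0 ∧ ∀ θ ∈ Θ, Ψ p θ = 0 → θ = θhat p)
    (h0 : Tendsto (fun p => Ψ p θ₀) l (𝓝 0)) :
    (fun p => θhat p - θ₀ + A.symm (Ψ p θ₀)) =o[l] fun p => Ψ p θ₀ := by
  -- In the trivial space `A.symm` has norm zero and the constant `c₀` below would not be positive.
  rcases subsingleton_or_nontrivial E with hE | hE
  · refine (isLittleO_zero (fun p => Ψ p θ₀) l).congr_left fun p => Subsingleton.elim _ _
  have hA : 0 < ‖(A.symm : E →L[ℝ] E)‖₊ := A.nnnorm_symm_pos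
  -- With half of the critical constant, the image of a ball of radius `ε` covers a ball of radius
  -- `(‖A⁻¹‖⁻¹ - c₀) ε = c₀ ε` around `Ψ p θ₀`, which contains 0 as soon as `‖Ψ p θ₀‖ < c₀ ε`.
  set c₀ : NNReal := ‖(A.symm : E →L[ℝ] E)‖₊⁻¹ / 2 with hc₀
  have hc₀pos : 0 < c₀ := by positivity
  have hcons : Tendsto θhat l (𝓝 θ₀) := by
    rw [Metric.tendsto_nhds]
    intro η hη
    obtain ⟨δ, hδ, hδΘ, hap⟩ := hlin c₀ hc₀pos
    set ε := min (η / 2) (δ / 2) with hε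
    have hεpos : 0 < ε := by positivity
    have hεδ : ε < δ := (min_le_right _ _).trans_lt (by linarith)
    have hεη : ε < η := (min_le_left _ _).trans_lt (by linarith)
    have hsub : Metric.closedBall θ₀ ε ⊆ Metric.ball θ₀ δ := Metric.closedBall_subset_ball hεδ
    have hc₀' : (0 : ℝ) < c₀ := hc₀pos
    have hsmall := (tendsto_zero_iff_norm_tendsto_zero.1 h0).eventually_lt_const
      (show (0 : ℝ) < c₀ * ε by positivity)
    filter_upwards [hap, hzero, hsmall] with p hp hz hs
    obtain ⟨θ, hθ, hθ0⟩ := hp.surjOn_closedBall_of_nonlinearRightInverse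
      A.toNonlinearRightInverse hεpos.le hsub (a := 0) (by
        rw [Metric.mem_closedBall, dist_zero_left]
        refine hs.le.trans (le_of_eq ?_)
        congr 1
        change (c₀ : ℝ) = (‖(A.symm : E →L[ℝ] E)‖₊ : ℝ)⁻¹ - c₀
        rw [hc₀]
        push_cast
        ring)
    -- The zero found near `θ₀` lies in `Θ`, so by uniqueness it is the estimator.
    rw [← hz.2 θ (hδΘ (hsub hθ)) hθ0]
    exact (Metric.mem_closedBall.1 hθ).trans_lt hεη
  have h1 : (fun p => θhat p - θ₀ + A.symm (Ψ p θ₀)) =o[l] fun p => θhat p - θ₀ := by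
    have h2 : (fun p => Ψ p θ₀ + A (θhat p - θ₀)) =o[l] fun p => θhat p - θ₀ := by
      rw [isLittleO_iff]
      intro c hc
      obtain ⟨δ, hδ, -, hap⟩ := hlin ⟨c, hc.le⟩ hc
      filter_upwards [hap, hzero, hcons (Metric.ball_mem_nhds θ₀ hδ)] with p hp hz hm
      have := hp (θhat p) hm θ₀ (Metric.mem_ball_self hδ)
      rw [hz.1, zero_sub, ← neg_add', norm_neg] at this
      exact this
    refine ((A.symm : E →L[ℝ] E).isBigO_comp (fun p => Ψ p θ₀ + A (θhat p - θ₀)) l).trans_isLittleO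
      h2 |>.congr_left fun p => ?_
    simp [add_comm]
  -- An error of order `o(θhat - θ₀)` can be absorbed, so `θhat - θ₀` is itself `O(A⁻¹ Ψ(θ₀))` and
  -- the error becomes `o(Ψ(θ₀))`.
  have h3 := h1.neg_left.right_isBigO_add
  have h4 : (fun p => θhat p - θ₀) =O[l] fun p => A.symm (Ψ p θ₀) := by
    refine h3.trans (IsBigO.of_bound 1 (.of_forall fun p => ?_))
    rw [one_mul, neg_add_rev, neg_add_cancel_right, norm_neg]
  exact h1.trans_isBigO (h4.trans ((A.symm : E →L[ℝ] E).isBigO_comp _ _))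

end ZEstimator

/-! ### The normalized estimating function at the true parameter. -/

section Score

variable {d q : ℕ} {Z : Type*} [MeasurableSpace Z] {P : Measure (Obs d Z)}
  {ψ : EstFun d q} {f : Z → ℝ} {Θ : Set (EuclideanSpace ℝ (Fin q))}
  {θ₀ ω : EuclideanSpace ℝ (Fin q)}
  {S : Type*} [MeasurableSpace S] {μ : Measure S}
  {L : ℕ → S → Obs d Z} {U : ℕ → S → UnlabObs d Z}

namespace PopulationConditions

lemma memLp_psiY (hP : PopulationConditions P ψ f Θ θ₀ ω) : MemLp (psiY ψ θ₀) 2 P := by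
  refine ⟨(hP.measurable_psiY hP.mem).aestronglyMeasurable, ?_⟩
  obtain ⟨C, hC⟩ := hP.moment_psiY
  rw [eLpNorm_lt_top_iff_lintegral_rpow_enorm_lt_top (by norm_num) (by norm_num)]
  simpa using (hC θ₀ hP.mem).trans_lt ENNReal.coe_lt_top

lemma memLp_psiF_map (hP : PopulationConditions P ψ f Θ θ₀ ω) :
    MemLp (psiF ψ f θ₀) 2 (P.map Prod.snd) :=
  (memLp_map_measure_iff (hP.measurable_psiF hP.mem).aestronglyMeasurable
    measurable_snd.aemeasurable).2 hP.memLp_psiF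

end PopulationConditions

/-- `ψ(f(z), x; θ)`, centered. -/
noncomputable def psiFc (P : Measure (Obs d Z)) (ψ : EstFun d q) (f : Z → ℝ)
    (θ : EuclideanSpace ℝ (Fin q)) (u : UnlabObs d Z) : EuclideanSpace ℝ (Fin q) :=
  psiF ψ f θ u - ∫ v, psiF ψ f θ v ∂P.map Prod.snd

namespace PopulationConditions

lemma measurable_psiFc (hP : PopulationConditions P ψ f Θ θ₀ ω) :
    Measurable (psiFc P ψ f θ₀) :=
  (hP.measurable_psiF hP.mem).sub_const _

lemma memLp_psiFc [IsProbabilityMeasure P] (hP : PopulationConditions P ψ f Θ θ₀ ω) :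
    MemLp (psiFc P ψ f θ₀) 2 (P.map Prod.snd) := by
  have := Measure.isProbabilityMeasure_map (μ := P) (f := Prod.snd) measurable_snd.aemeasurable
  exact hP.memLp_psiF_map.sub (memLp_const _)

lemma integral_psiFc [IsProbabilityMeasure P] (hP : PopulationConditions P ψ f Θ θ₀ ω) :
    ∫ u, psiFc P ψ f θ₀ u ∂P.map Prod.snd = 0 := by
  have := Measure.isProbabilityMeasure_map (μ := P) (f := Prod.snd) measurable_snd.aemeasurable
  simp only [psiFc]
  rw [integral_sub (hP.memLp_psiF_map.integrable (by norm_num)) (integrable_const _)]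
  simp

end PopulationConditions

/-- The leading term of the normalized sample estimating function at `θ₀`. -/
noncomputable def scoreTerm (P : Measure (Obs d Z)) (ψ : EstFun d q) (f : Z → ℝ) (n N : ℕ)
    (L : ℕ → Obs d Z) (U : ℕ → UnlabObs d Z) (ω θ : EuclideanSpace ℝ (Fin q)) :
    EuclideanSpace ℝ (Fin q) :=
  √n • avg n (fun i => psiY ψ θ (L i)) + diagMulL ω
    (√n • avg N (fun i => psiFc P ψ f θ (U i)) - √n • avg n fun i => psiFc P ψ f θ (L i).2)

/-- The centering constants of the two averages cancel in the difference, provided that neither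
sample is empty. -/
lemma smul_pspaFun_eq_scoreTerm {n N : ℕ} (hn : n ≠ 0) (hN : N ≠ 0) (L : ℕ → Obs d Z)
    (U : ℕ → UnlabObs d Z) (w θ : EuclideanSpace ℝ (Fin q)) :
    √n • pspaFun ψ f n N L U w θ = scoreTerm P ψ f n N L U w θ := by
  have h : avg N (fun i => psiFc P ψ f θ (U i)) - avg n (fun i => psiFc P ψ f θ (L i).2)
      = avg N (fun i => psiF ψ f θ (U i)) - avg n fun i => psiF ψ f θ (L i).2 := by
    simp only [psiFc]
    rw [avg_sub, avg_sub, avg_const hn, avg_const hN]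
    abel
  rw [pspaFun_eq, scoreTerm, ← smul_sub, h, smul_add, map_smul]

variable {N : ℕ → ℕ} {ρ : ℝ} {ωhat : ℕ → S → EuclideanSpace ℝ (Fin q)}

/-- The difference is `diag(ωhat - ω)` applied to the centered correction, and `ωhat - ω` tends to
0. -/
lemma isLittleO_score_sub_scoreTerm (hN : Tendsto N atTop atTop)
    (hω : Tendsto (fun p : ℕ × S => ωhat p.1 p.2) (whp μ) (𝓝 ω)) :
    (fun p : ℕ × S => √p.1 • pspaFun ψ f p.1 (N p.1) (fun i => L i p.2) (fun i => U i p.2)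
        (ωhat p.1 p.2) θ₀
      - scoreTerm P ψ f p.1 (N p.1) (fun i => L i p.2) (fun i => U i p.2) ω θ₀) =o[whp μ]
    fun p => √p.1 • avg (N p.1) (fun i => psiFc P ψ f θ₀ (U i p.2))
      - √p.1 • avg p.1 fun i => psiFc P ψ f θ₀ (L i p.2).2 := by
  rw [isLittleO_iff]
  intro c hc
  have h1 : Tendsto (fun p : ℕ × S => ‖ωhat p.1 p.2 - ω‖) (whp μ) (𝓝 0) := by
    simpa using (hω.sub_const ω).norm
  filter_upwards [h1.eventually_lt_const hc, tendsto_fst_whp.eventually (eventually_ne_atTop 0),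
    tendsto_fst_whp.eventually (hN.eventually_ne_atTop 0)] with p hp hn hN'
  rw [smul_pspaFun_eq_scoreTerm (P := P) hn hN', scoreTerm, scoreTerm, add_sub_add_left_eq_sub,
    diagMulL_apply, diagMulL_apply, ← diagMul_sub_left]
  refine (norm_diagMul_le _ _).trans ?_
  gcongr

variable [IsProbabilityMeasure P] [IsProbabilityMeasure μ]

/-- Write `√n = √(n / N) √N`; the first factor converges, hence is bounded. -/
lemma IsIID.bddInProb_of_ratio {V : Type*} [MeasurableSpace V] {Q : Measure V} {X : ℕ → S → V}
    (h : IsIID μ Q X) {g : V → EuclideanSpace ℝ (Fin q)} (hg : Measurable g)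
    (hL : MemLp g 2 Q) (h0 : ∫ v, g v ∂Q = 0) (hN : Tendsto N atTop atTop)
    (hρ : Tendsto (fun n : ℕ => (n : ℝ) / (N n : ℝ)) atTop (𝓝 ρ)) :
    BddInProb μ fun n s => √n • avg (N n) fun i => g (X i s) := by
  refine ((h.bddInProb hg hL h0).comp hN).of_isBigO ?_
  have h1 : (fun p : ℕ × S => √((p.1 : ℝ) / N p.1)) =O[whp μ] fun _ => (1 : ℝ) :=
    (((Real.continuous_sqrt.tendsto _).comp hρ).comp tendsto_fst_whp).isBigO_one ℝ
  have h2 := h1.smul (isBigO_refl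
    (fun p : ℕ × S => √(N p.1) • avg (N p.1) fun i => g (X i p.2)) (whp μ))
  simp only [one_smul] at h2
  refine h2.congr' ?_ EventuallyEq.rfl
  filter_upwards [tendsto_fst_whp.eventually (hN.eventually_ne_atTop 0)] with p hp
  have hpos : (0 : ℝ) < N p.1 := by
    have := Nat.pos_of_ne_zero hp
    exact_mod_cast this
  rw [smul_smul, ← Real.sqrt_mul (by positivity), div_mul_cancel₀ _ hpos.ne']

namespace PopulationConditions

lemma bddInProb_correction (hP : PopulationConditions P ψ f Θ θ₀ ω) (hdata : IsSample μ P L U)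
    (hN : Tendsto N atTop atTop)
    (hρ : Tendsto (fun n : ℕ => (n : ℝ) / (N n : ℝ)) atTop (𝓝 ρ)) :
    BddInProb μ fun n s => √n • avg (N n) (fun i => psiFc P ψ f θ₀ (U i s))
      - √n • avg n fun i => psiFc P ψ f θ₀ (L i s).2 := by
  have h2 := hdata.iid_labeled_snd.bddInProb hP.measurable_psiFc hP.memLp_psiFc hP.integral_psiFc
  have h3 := hdata.iid_unlabeled.bddInProb_of_ratio hP.measurable_psiFc hP.memLp_psiFc
    hP.integral_psiFc hN hρ
  simp only [sub_eq_add_neg]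
  exact h3.add h2.neg

lemma bddInProb_scoreTerm (hP : PopulationConditions P ψ f Θ θ₀ ω) (hdata : IsSample μ P L U)
    (hN : Tendsto N atTop atTop)
    (hρ : Tendsto (fun n : ℕ => (n : ℝ) / (N n : ℝ)) atTop (𝓝 ρ)) :
    BddInProb μ fun n s =>
      scoreTerm P ψ f n (N n) (fun i => L i s) (fun i => U i s) ω θ₀ :=
  (hdata.iid_labeled.bddInProb (hP.measurable_psiY hP.mem) hP.memLp_psiY hP.zero).add
    ((hP.bddInProb_correction hdata hN hρ).map_clm (diagMulL ω))

lemma tendsto_score (hP : PopulationConditions P ψ f Θ θ₀ ω) (hdata : IsSample μ P L U)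
    (hN : Tendsto N atTop atTop)
    (hρ : Tendsto (fun n : ℕ => (n : ℝ) / (N n : ℝ)) atTop (𝓝 ρ))
    (hω : Tendsto (fun p : ℕ × S => ωhat p.1 p.2) (whp μ) (𝓝 ω)) :
    Tendsto (fun p : ℕ × S => √p.1 • pspaFun ψ f p.1 (N p.1) (fun i => L i p.2) (fun i => U i p.2)
        (ωhat p.1 p.2) θ₀
      - scoreTerm P ψ f p.1 (N p.1) (fun i => L i p.2) (fun i => U i p.2) ω θ₀) (whp μ) (𝓝 0) :=
  BddInProb.tendsto_zero_of_isLittleO (hP.bddInProb_correction hdata hN hρ)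
    (R := fun n s => √n • pspaFun ψ f n (N n) (fun i => L i s) (fun i => U i s)
        (ωhat n s) θ₀ - scoreTerm P ψ f n (N n) (fun i => L i s) (fun i => U i s) ω θ₀)
    (isLittleO_score_sub_scoreTerm hN hω)

lemma bddInProb_score (hP : PopulationConditions P ψ f Θ θ₀ ω) (hdata : IsSample μ P L U)
    (hN : Tendsto N atTop atTop)
    (hρ : Tendsto (fun n : ℕ => (n : ℝ) / (N n : ℝ)) atTop (𝓝 ρ))
    (hω : Tendsto (fun p : ℕ × S => ωhat p.1 p.2) (whp μ) (𝓝 ω)) :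
    BddInProb μ fun n s => √n • pspaFun ψ f n (N n) (fun i => L i s) (fun i => U i s)
      (ωhat n s) θ₀ := by
  have h1 : BddInProb μ fun n s => √n • pspaFun ψ f n (N n) (fun i => L i s) (fun i => U i s)
        (ωhat n s) θ₀ - scoreTerm P ψ f n (N n) (fun i => L i s) (fun i => U i s) ω θ₀ :=
    (hP.bddInProb_correction hdata hN hρ).of_isBigO (isLittleO_score_sub_scoreTerm hN hω).isBigO
  simpa using h1.add (hP.bddInProb_scoreTerm hdata hN hρ)

/-- The asymptotic linear expansion of the estimator. -/
lemma tendsto_estimator_expansion (hP : PopulationConditions P ψ f Θ θ₀ ω)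
    (hdata : IsSample μ P L U) (hN : Tendsto N atTop atTop)
    (hρ : Tendsto (fun n : ℕ => (n : ℝ) / (N n : ℝ)) atTop (𝓝 ρ))
    (hω : Tendsto (fun p : ℕ × S => ωhat p.1 p.2) (whp μ) (𝓝 ω))
    {θhat : ℕ → S → EuclideanSpace ℝ (Fin q)}
    (hzero : ∀ᶠ p : ℕ × S in whp μ,
      pspaFun ψ f p.1 (N p.1) (fun i => L i p.2) (fun i => U i p.2) (ωhat p.1 p.2)
        (θhat p.1 p.2) = 0 ∧
      ∀ θ ∈ Θ, pspaFun ψ f p.1 (N p.1) (fun i => L i p.2) (fun i => U i p.2) (ωhat p.1 p.2) θ = 0 →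
        θ = θhat p.1 p.2) :
    Tendsto (fun p : ℕ × S => √p.1 • (θhat p.1 p.2 - θ₀)
      + Matrix.toEuclideanCLM (𝕜 := ℝ) (matA P ψ θ₀)⁻¹
        (scoreTerm P ψ f p.1 (N p.1) (fun i => L i p.2) (fun i => U i p.2) ω θ₀))
      (whp μ) (𝓝 0) := by
  set T := Matrix.toEuclideanCLM (𝕜 := ℝ) (matA P ψ θ₀) with hT
  set T' := Matrix.toEuclideanCLM (𝕜 := ℝ) (matA P ψ θ₀)⁻¹ with hT'
  have hdet : IsUnit (matA P ψ θ₀).det := hP.nonsingular.isUnit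
  have hTT' : T * T' = 1 := by
    rw [hT, hT', ← map_mul, Matrix.mul_nonsing_inv _ hdet, map_one]
  have hT'T : T' * T = 1 := by
    rw [hT, hT', ← map_mul, Matrix.nonsing_inv_mul _ hdet, map_one]
  set A : EuclideanSpace ℝ (Fin q) ≃L[ℝ] EuclideanSpace ℝ (Fin q) :=
    ContinuousLinearEquiv.equivOfInverse T T' (fun x => DFunLike.congr_fun hT'T x)
      (fun x => DFunLike.congr_fun hTT' x) with hA
  set Ψ : ℕ → S → EuclideanSpace ℝ (Fin q) → EuclideanSpace ℝ (Fin q) := fun n s =>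
    pspaFun ψ f n (N n) (fun i => L i s) (fun i => U i s) (ωhat n s) with hΨ
  have hB : BddInProb μ fun n s => √n • Ψ n s θ₀ := hP.bddInProb_score hdata hN hρ hω
  -- A quantity bounded in probability, divided by `√n`.
  have h0 : Tendsto (fun p : ℕ × S => Ψ p.1 p.2 θ₀) (whp μ) (𝓝 0) := by
    refine hB.tendsto_zero_of_isLittleO (R := fun n s => Ψ n s θ₀) ?_
    have h1 : (fun p : ℕ × S => (√(p.1 : ℝ))⁻¹) =o[whp μ] fun _ => (1 : ℝ) := by
      rw [isLittleO_one_iff]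
      exact (tendsto_inv_atTop_zero.comp (Real.tendsto_sqrt_atTop.comp
        tendsto_natCast_atTop_atTop)).comp tendsto_fst_whp
    have h2 := h1.smul_isBigO (isBigO_refl (fun p : ℕ × S => √(p.1 : ℝ) • Ψ p.1 p.2 θ₀) (whp μ))
    simp only [one_smul] at h2
    refine h2.congr' ?_ EventuallyEq.rfl
    filter_upwards [tendsto_fst_whp.eventually (eventually_ne_atTop 0)] with p hp
    have : √(p.1 : ℝ) ≠ 0 := by
      rw [Real.sqrt_ne_zero']
      exact_mod_cast Nat.pos_of_ne_zero hp
    rw [smul_smul, inv_mul_cancel₀ this, one_smul]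
  have h3 := isLittleO_zero_expansion (l := whp μ) (Ψ := fun p : ℕ × S => Ψ p.1 p.2)
    (θhat := fun p => θhat p.1 p.2) A
    (fun c hc => hP.exists_approximatesLinearOn hdata hN hω hc) hzero h0
  have h4 : Tendsto (fun p : ℕ × S => √p.1 • (θhat p.1 p.2 - θ₀ + A.symm (Ψ p.1 p.2 θ₀)))
      (whp μ) (𝓝 0) :=
    hB.tendsto_zero_of_isLittleO
      (R := fun n s => √n • (θhat n s - θ₀ + A.symm (Ψ n s θ₀)))
      ((isBigO_refl (fun p : ℕ × S => √(p.1 : ℝ)) (whp μ)).smul_isLittleO h3)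
  have h5 := (T'.continuous.tendsto 0).comp (hP.tendsto_score hdata hN hρ hω)
  rw [map_zero] at h5
  have h6 := h4.sub h5
  rw [sub_zero] at h6
  refine h6.congr fun p => ?_
  have : A.symm (Ψ p.1 p.2 θ₀) = T' (Ψ p.1 p.2 θ₀) := rfl
  rw [this, Function.comp_apply, map_sub, map_smul, smul_add]
  abel

end PopulationConditions

end Score

/-! ### Central limit theorem for two independent samples. -/

section CentralLimit

variable {S : Type*} [MeasurableSpace S] {μ : Measure S}
  {V W : Type*} [MeasurableSpace V] [MeasurableSpace W] {Q : Measure V} {Q' : Measure W}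
  {X : ℕ → S → V} {Y : ℕ → S → W}

lemma aemeasurable_avg (hX : ∀ i, Measurable (X i)) {g : V → ℝ} (hg : Measurable g) (c : ℝ)
    (n : ℕ) : AEMeasurable (fun s => c * avg n fun i => g (X i s)) μ := by
  simp only [avg, smul_eq_mul]
  have : Measurable fun s => ∑ i ∈ Finset.range n, g (X i s) :=
    Finset.measurable_fun_sum _ fun i _ => hg.comp (hX i)
  fun_prop

variable [IsProbabilityMeasure μ]

/-- The central limit theorem for a function of i.i.d. variables. -/
lemma IsIID.tendstoInDistribution (h : IsIID μ Q X) {g : V → ℝ} (hg : Measurable g)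
    (hL : MemLp g 2 Q) (h0 : ∫ v, g v ∂Q = 0) :
    TendstoInDistribution (fun (n : ℕ) s => √n * avg n fun i => g (X i s)) atTop id
      (fun _ => μ) (gaussianReal 0 Var[g; Q].toNNReal) := by
  have hvar : Var[fun s => g (X 0 s); μ] = Var[g; Q] := by
    rw [← h.law 0, variance_map hg.aemeasurable (h.measurable 0).aemeasurable]
    rfl
  have hmean : ∫ s, g (X 0 s) ∂μ = 0 := by
    rw [← h0, ← h.law 0,
      integral_map (h.measurable 0).aemeasurable hg.aestronglyMeasurable]
  have h1 := tendstoInDistribution_inv_sqrt_mul_sum_sub (X := fun i s => g (X i s)) (P := μ)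
    (P' := gaussianReal 0 Var[g; Q].toNNReal) (Y := id) (by rw [hvar]; exact HasLaw.id)
    (hL.comp_measurePreserving (h.measurePreserving 0))
    (h.indep.comp (fun _ => g) fun _ => hg) (fun i => (h.identDistrib i 0).comp hg)
  refine h1.congr (fun n => .of_forall fun s => ?_) .rfl
  simp only [hmean, mul_zero, sub_zero, avg, smul_eq_mul, ← mul_assoc]
  congr 1
  rcases Nat.eq_zero_or_pos n with rfl | hn
  · simp
  have : (0 : ℝ) < n := by exact_mod_cast hn
  rw [← div_eq_mul_inv, Real.sqrt_div_self']
  simp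

/-- The central limit theorem for two independent samples whose sizes have ratio `ρ`. -/
lemma IsIID.tendstoInDistribution_add (hX : IsIID μ Q X) (hY : IsIID μ Q' Y)
    (hXY : IndepFun (fun s i => X i s) (fun s i => Y i s) μ)
    {g : V → ℝ} (hg : Measurable g) (hgL : MemLp g 2 Q) (hg0 : ∫ v, g v ∂Q = 0)
    {k : W → ℝ} (hk : Measurable k) (hkL : MemLp k 2 Q') (hk0 : ∫ w, k w ∂Q' = 0)
    {N : ℕ → ℕ} (hN : Tendsto N atTop atTop) {ρ : ℝ}
    (hρ : Tendsto (fun n : ℕ => (n : ℝ) / (N n : ℝ)) atTop (𝓝 ρ)) :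
    TendstoInDistribution
      (fun (n : ℕ) s => √n * avg n (fun i => g (X i s)) + √n * avg (N n) fun i => k (Y i s))
      atTop id (fun _ => μ) (gaussianReal 0 (Var[g; Q] + ρ * Var[k; Q']).toNNReal) := by
  have hρ0 : 0 ≤ ρ := ge_of_tendsto' hρ fun n => by positivity
  have h1 := hX.tendstoInDistribution hg hgL hg0
  have h2 : TendstoInDistribution
      (fun (n : ℕ) s => √(N n) * avg (N n) fun i => k (Y i s)) atTop id (fun _ => μ)
      (gaussianReal 0 Var[k; Q'].toNNReal) := by
    have := hY.tendstoInDistribution hk hkL hk0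
    exact ⟨fun n => this.forall_aemeasurable (N n), this.aemeasurable_limit,
      this.tendsto.comp hN⟩
  -- The ratio is deterministic, but phrased in measure so that Slutsky's theorem can change the
  -- normalization of the second sample from `√N` to `√n`.
  have hr : TendstoInMeasure μ (fun (n : ℕ) (_ : S) => √((n : ℝ) / N n)) atTop fun _ => √ρ :=
    tendsto_whp_iff_tendstoInMeasure.1
      (((Real.continuous_sqrt.tendsto _).comp hρ).comp tendsto_fst_whp)
  have h3 := h2.continuous_comp_prodMk_of_tendstoInMeasure_const
    (g := fun p : ℝ × ℝ => p.2 * p.1) (by fun_prop) hr (fun _ => aemeasurable_const)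
  have hA1 := aemeasurable_avg (μ := μ) hX.measurable hg
  have hA2 := aemeasurable_avg (μ := μ) hY.measurable hk
  refine ⟨fun n => (hA1 _ n).add (hA2 _ (N n)), aemeasurable_id, ?_⟩
  -- By Lévy's theorem it suffices to multiply characteristic functions, which independence of the
  -- samples permits.
  refine ProbabilityMeasure.tendsto_iff_tendsto_charFun.2 fun t => ?_
  have c1 := (ProbabilityMeasure.tendsto_iff_tendsto_charFun.1 h1.tendsto) t
  have c3 := (ProbabilityMeasure.tendsto_iff_tendsto_charFun.1 h3.tendsto) t
  have hlim := c1.mul c3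
  simp only [ProbabilityMeasure.coe_mk, id] at hlim ⊢
  rw [Measure.map_id, charFun_gaussianReal, gaussianReal_map_const_mul, charFun_gaussianReal,
    ← Complex.exp_add] at hlim
  rw [Measure.map_id, charFun_gaussianReal]
  refine Tendsto.congr' ?_ (hlim.trans_eq ?_)
  · filter_upwards [hN.eventually_ne_atTop 0] with n hn
    have hind : IndepFun (fun s => √n * avg n fun i => g (X i s))
        (fun s => √n * avg (N n) fun i => k (Y i s)) μ := by
      refine hXY.comp (φ := fun x : ℕ → V => √n * avg n fun i => g (x i))
        (ψ := fun y : ℕ → W => √n * avg (N n) fun i => k (y i)) ?_ ?_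
      all_goals
        simp only [avg, smul_eq_mul]
        fun_prop
    rw [hind.charFun_map_fun_add_eq_mul (hA1 _ n) (hA2 _ (N n)), Pi.mul_apply]
    congr 4
    ext s
    have hpos : (0 : ℝ) < N n := by
      have := Nat.pos_of_ne_zero hn
      exact_mod_cast this
    rw [← mul_assoc, ← Real.sqrt_mul (by positivity), div_mul_cancel₀ _ hpos.ne']
  · congr 2
    have hv1 : 0 ≤ Var[g; Q] := variance_nonneg _ _
    have hv2 : 0 ≤ Var[k; Q'] := variance_nonneg _ _
    have e1 : (Var[g; Q].toNNReal : ℝ) = Var[g; Q] := Real.coe_toNNReal _ hv1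
    have e2 : ((NNReal.mk (√ρ ^ 2) (sq_nonneg _) * Var[k; Q'].toNNReal : NNReal) : ℝ)
        = ρ * Var[k; Q'] := by
      rw [NNReal.coe_mul, NNReal.coe_mk, Real.sq_sqrt hρ0, Real.coe_toNNReal _ hv2]
    have e3 : ((Var[g; Q] + ρ * Var[k; Q']).toNNReal : ℝ) = Var[g; Q] + ρ * Var[k; Q'] :=
      Real.coe_toNNReal _ (by positivity)
    rw [e1, e2, e3]
    push_cast
    ring

end CentralLimit

/-! ### Normal quantiles and two-sided tails. -/

section Quantile

/-- Points just right of the infimum satisfy the inequality, and right continuity of the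
distribution function carries it to the infimum. -/
lemma le_cdf_stdNormalQuantile {p : ℝ} (hp : p < 1) :
    p ≤ cdf (gaussianReal 0 1) (stdNormalQuantile p) := by
  set F := cdf (gaussianReal 0 1)
  have hne : {x : ℝ | p ≤ F x}.Nonempty :=
    ((Tendsto.eventually_const_le hp (tendsto_cdf_atTop (gaussianReal 0 1)))).exists
  refine ge_of_tendsto ((F.right_continuous (stdNormalQuantile p)).mono_left
    (nhdsWithin_mono _ Set.Ioi_subset_Ici_self)) ?_
  filter_upwards [self_mem_nhdsWithin] with y hy
  obtain ⟨x, hx, hxy⟩ := exists_lt_of_csInf_lt hne hy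
  exact (Set.mem_ofPred.1 hx).trans (F.mono hxy.le)

/-- Each tail has mass at most `α / 2`: the right one by the quantile inequality and absence of
atoms, the left one by symmetry. -/
lemma one_sub_le_gaussianReal_abs_lt {α : ℝ} (hα : 0 < α) :
    1 - α ≤ (gaussianReal 0 1).real {x | |x| < stdNormalQuantile (1 - α / 2)} := by
  set z := stdNormalQuantile (1 - α / 2)
  set γ := gaussianReal 0 1
  have : NullSingletonClass γ := nullSingletonClass_gaussianReal one_ne_zero
  have hz : 1 - α / 2 ≤ γ.real (Set.Iic z) := by
    rw [← cdf_eq_real]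
    exact le_cdf_stdNormalQuantile (by linarith)
  have hIci : γ.real (Set.Ici z) ≤ α / 2 := by
    have h2 : γ.real (Set.Ici z) = γ.real (Set.Ioi z) := measureReal_congr Ioi_ae_eq_Ici.symm
    have h3 := probReal_compl_eq_one_sub (μ := γ) (measurableSet_Iic (a := z))
    rw [Set.compl_Iic] at h3
    linarith
  have hIic : γ.real (Set.Iic (-z)) = γ.real (Set.Ici z) := by
    have h2 : γ.map (fun x => -x) = γ := by simpa using gaussianReal_map_neg (μ := 0) (v := 1)
    nth_rw 2 [← h2]
    rw [map_measureReal_apply measurable_neg measurableSet_Ici]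
    simp
  have hs : MeasurableSet {x : ℝ | |x| < z} := measurableSet_lt (by fun_prop) (by fun_prop)
  have hc := probReal_compl_eq_one_sub (μ := γ) hs
  have hle : γ.real {x : ℝ | |x| < z}ᶜ ≤ γ.real (Set.Ici z ∪ Set.Iic (-z)) := by
    refine measureReal_mono fun x hx => ?_
    simp only [Set.mem_compl_iff, Set.mem_ofPred_eq, not_lt, le_abs] at hx
    exact hx.imp id fun h => by simpa using le_neg_of_le_neg h
  have := measureReal_union_le (μ := γ) (Set.Ici z) (Set.Iic (-z))
  linarith

lemma gaussianReal_toNNReal_real_abs_lt {v : ℝ} (hv : 0 < v) (z : ℝ) :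
    (gaussianReal 0 v.toNNReal).real {x | |x| < z * √v} = (gaussianReal 0 1).real {x | |x| < z} := by
  have h : gaussianReal 0 v.toNNReal = (gaussianReal 0 1).map (√v * ·) := by
    rw [gaussianReal_map_const_mul]
    congr 1
    · simp
    · ext
      simp [Real.sq_sqrt hv.le, hv.le]
  have hs : MeasurableSet {x : ℝ | |x| < z * √v} := measurableSet_lt (by fun_prop) (by fun_prop)
  rw [h, map_measureReal_apply (by fun_prop) hs]
  congr 1
  ext x
  have : 0 < √v := Real.sqrt_pos.2 hv
  simp only [Set.mem_preimage, Set.mem_ofPred_eq, abs_mul, abs_of_pos this, mul_comm z]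
  exact mul_lt_mul_iff_right₀ this

end Quantile

/-! ### Influence functions and their variance. -/

section AsymptoticVariance

variable {d q : ℕ} {Z : Type*} [MeasurableSpace Z] {P : Measure (Obs d Z)}
  {ψ : EstFun d q} {f : Z → ℝ} {Θ : Set (EuclideanSpace ℝ (Fin q))}
  {θ₀ ω : EuclideanSpace ℝ (Fin q)} {ρ : ℝ}

lemma asympCov_apply (P : Measure (Obs d Z)) (ψ : EstFun d q) (f : Z → ℝ) (ρ : ℝ)
    (ω θ : EuclideanSpace ℝ (Fin q)) (j : Fin q) :
    asympCov P ψ f ρ ω θ j j = ∑ k, ∑ l, (matA P ψ θ)⁻¹ j k * (matA P ψ θ)⁻¹ j l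
      * (matM1 P ψ θ k l + ω k * (matM2 P ψ f θ k l + ρ * matM3 P ψ f θ k l) * ω l
        - (ω k * matM4 P ψ f θ l k + matM4 P ψ f θ k l * ω l)) := by
  rw [asympCov, Matrix.mul_apply, Finset.sum_comm]
  refine Finset.sum_congr rfl fun l _ => ?_
  rw [Matrix.mul_apply, Finset.sum_mul]
  refine Finset.sum_congr rfl fun k _ => ?_
  simp only [matV, Matrix.transpose_apply, Matrix.sub_apply, Matrix.add_apply,
    Matrix.diagonal_mul, Matrix.mul_diagonal, Matrix.smul_apply, smul_eq_mul]
  ring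

lemma variance_sum_mul {V : Type*} [MeasurableSpace V] {Q : Measure V} [IsProbabilityMeasure Q]
    {W : Fin q → V → ℝ} (hW : ∀ k, MemLp (W k) 2 Q) (a : Fin q → ℝ) (c : ℝ) :
    Var[fun v => ∑ k, a k * W k v + c; Q] = ∑ k, ∑ l, a k * a l * cov[W k, W l; Q] := by
  have h1 : ∀ k, MemLp (fun v => a k * W k v) 2 Q := fun k => (hW k).const_mul _
  rw [variance_add_const (memLp_finsetSum _ fun k _ => h1 k).aestronglyMeasurable,
    ← covariance_self (memLp_finsetSum _ fun k _ => h1 k).aemeasurable,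
    covariance_fun_sum_fun_sum h1 h1]
  refine Finset.sum_congr rfl fun k _ => Finset.sum_congr rfl fun l _ => ?_
  rw [covariance_const_mul_left, covariance_const_mul_right, mul_assoc]

/-- The influence function of the `j`-th coordinate of the estimator, labeled part. -/
noncomputable def influenceL (P : Measure (Obs d Z)) (ψ : EstFun d q) (f : Z → ℝ)
    (ω θ : EuclideanSpace ℝ (Fin q)) (j : Fin q) (o : Obs d Z) : ℝ :=
  -(Matrix.toEuclideanCLM (𝕜 := ℝ) (matA P ψ θ)⁻¹ (psiY ψ θ o - diagMulL ω (psiFc P ψ f θ o.2))) j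

/-- The influence function of the `j`-th coordinate of the estimator, unlabeled part. -/
noncomputable def influenceU (P : Measure (Obs d Z)) (ψ : EstFun d q) (f : Z → ℝ)
    (ω θ : EuclideanSpace ℝ (Fin q)) (j : Fin q) (u : UnlabObs d Z) : ℝ :=
  -(Matrix.toEuclideanCLM (𝕜 := ℝ) (matA P ψ θ)⁻¹ (diagMulL ω (psiFc P ψ f θ u))) j

/-- The linear functional `v ↦ -(A⁻¹ v)_j`. -/
noncomputable def influenceCLM (P : Measure (Obs d Z)) (ψ : EstFun d q)
    (θ : EuclideanSpace ℝ (Fin q)) (j : Fin q) : EuclideanSpace ℝ (Fin q) →L[ℝ] ℝ :=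
  -(EuclideanSpace.proj j ∘L Matrix.toEuclideanCLM (𝕜 := ℝ) (matA P ψ θ)⁻¹)

lemma influenceCLM_apply (v : EuclideanSpace ℝ (Fin q)) (j : Fin q) :
    influenceCLM P ψ θ₀ j v = -(Matrix.toEuclideanCLM (𝕜 := ℝ) (matA P ψ θ₀)⁻¹ v) j := rfl

lemma influenceCLM_apply_sum (v : EuclideanSpace ℝ (Fin q)) (j : Fin q) :
    influenceCLM P ψ θ₀ j v = ∑ k, -(matA P ψ θ₀)⁻¹ j k * v k := by
  rw [influenceCLM_apply]
  simp [Matrix.ofLp_toEuclideanCLM, Matrix.mulVec, dotProduct, Finset.sum_neg_distrib]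

lemma influenceCLM_scoreTerm (n N : ℕ) (L : ℕ → Obs d Z) (U : ℕ → UnlabObs d Z) (j : Fin q) :
    influenceCLM P ψ θ₀ j (scoreTerm P ψ f n N L U ω θ₀)
      = √n * avg n (fun i => influenceL P ψ f ω θ₀ j (L i))
        + √n * avg N (fun i => influenceU P ψ f ω θ₀ j (U i)) := by
  have h1 : avg n (fun i => influenceL P ψ f ω θ₀ j (L i)) = influenceCLM P ψ θ₀ j
      (avg n (fun i => psiY ψ θ₀ (L i)) - diagMulL ω (avg n fun i => psiFc P ψ f θ₀ (L i).2)) := by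
    rw [map_avg (diagMulL ω), ← avg_sub, map_avg]
    rfl
  have h2 : avg N (fun i => influenceU P ψ f ω θ₀ j (U i)) = influenceCLM P ψ θ₀ j
      (diagMulL ω (avg N fun i => psiFc P ψ f θ₀ (U i))) := by
    rw [map_avg (diagMulL ω), map_avg]
    rfl
  rw [h1, h2, ← smul_eq_mul, ← smul_eq_mul, ← map_smul, ← map_smul, ← map_add, scoreTerm]
  simp only [map_sub, smul_sub, map_smul]
  congr 1
  abel

namespace PopulationConditions

lemma measurable_influenceU (hP : PopulationConditions P ψ f Θ θ₀ ω) (j : Fin q) :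
    Measurable (influenceU P ψ f ω θ₀ j) :=
  ((influenceCLM P ψ θ₀ j).comp (diagMulL ω)).measurable.comp hP.measurable_psiFc

lemma measurable_influenceL (hP : PopulationConditions P ψ f Θ θ₀ ω) (j : Fin q) :
    Measurable (influenceL P ψ f ω θ₀ j) :=
  (influenceCLM P ψ θ₀ j).measurable.comp ((hP.measurable_psiY hP.mem).sub
    ((diagMulL ω).measurable.comp (hP.measurable_psiFc.comp measurable_snd)))

variable [IsProbabilityMeasure P]

lemma memLp_influenceU (hP : PopulationConditions P ψ f Θ θ₀ ω) (j : Fin q) :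
    MemLp (influenceU P ψ f ω θ₀ j) 2 (P.map Prod.snd) :=
  hP.memLp_psiFc.continuousLinearMap_comp ((influenceCLM P ψ θ₀ j).comp (diagMulL ω))

lemma memLp_psiFc_snd (hP : PopulationConditions P ψ f Θ θ₀ ω) :
    MemLp (fun o : Obs d Z => psiFc P ψ f θ₀ o.2) 2 P :=
  hP.memLp_psiFc.comp_measurePreserving ⟨measurable_snd, rfl⟩

lemma memLp_influenceL (hP : PopulationConditions P ψ f Θ θ₀ ω) (j : Fin q) :
    MemLp (influenceL P ψ f ω θ₀ j) 2 P :=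
  (hP.memLp_psiY.sub (hP.memLp_psiFc_snd.continuousLinearMap_comp
    (diagMulL ω))).continuousLinearMap_comp (influenceCLM P ψ θ₀ j)

lemma integral_influenceU (hP : PopulationConditions P ψ f Θ θ₀ ω) (j : Fin q) :
    ∫ u, influenceU P ψ f ω θ₀ j u ∂P.map Prod.snd = 0 := by
  have := Measure.isProbabilityMeasure_map (μ := P) (f := Prod.snd) measurable_snd.aemeasurable
  have h := ((influenceCLM P ψ θ₀ j).comp (diagMulL ω)).integral_comp_comm
    (hP.memLp_psiFc.integrable (by norm_num))
  rw [hP.integral_psiFc, map_zero] at h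
  exact h

lemma integral_influenceL (hP : PopulationConditions P ψ f Θ θ₀ ω) (j : Fin q) :
    ∫ o, influenceL P ψ f ω θ₀ j o ∂P = 0 := by
  have hY := hP.memLp_psiY.integrable (by norm_num : (1 : ENNReal) ≤ 2)
  have hF := hP.memLp_psiFc_snd.integrable (by norm_num : (1 : ENNReal) ≤ 2)
  have hF' := (hP.memLp_psiFc_snd.continuousLinearMap_comp (diagMulL ω)).integrable
    (by norm_num : (1 : ENNReal) ≤ 2)
  have h0 : ∫ o : Obs d Z, psiFc P ψ f θ₀ o.2 ∂P = 0 := by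
    rw [← hP.integral_psiFc, integral_map measurable_snd.aemeasurable
      hP.measurable_psiFc.aestronglyMeasurable]
  have h := (influenceCLM P ψ θ₀ j).integral_comp_comm (hY.sub hF')
  have h2 := (diagMulL ω).integral_comp_comm hF
  simp only [Pi.sub_apply] at h
  rw [integral_sub hY hF', h2, h0, hP.zero, map_zero, sub_zero, map_zero] at h
  exact h

/-- Centering does not affect variances. The labeled part yields `M₁`, `M₂` and the cross terms with
`M₄`, the unlabeled part yields `ρ M₃`; the two sides agree entry by entry in the double sum. -/
lemma variance_influence (hP : PopulationConditions P ψ f Θ θ₀ ω) (j : Fin q) :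
    Var[influenceL P ψ f ω θ₀ j; P] + ρ * Var[influenceU P ψ f ω θ₀ j; P.map Prod.snd]
      = asympCov P ψ f ρ ω θ₀ j j := by
  have := Measure.isProbabilityMeasure_map (μ := P) (f := Prod.snd) measurable_snd.aemeasurable
  have hYk : ∀ k, MemLp (fun o => psiY ψ θ₀ o k) 2 P := fun k =>
    hP.memLp_psiY.continuousLinearMap_comp (EuclideanSpace.proj (𝕜 := ℝ) k)
  have hFk : ∀ k, MemLp (fun o : Obs d Z => psiF ψ f θ₀ o.2 k) 2 P := fun k =>
    hP.memLp_psiF.continuousLinearMap_comp (EuclideanSpace.proj (𝕜 := ℝ) k)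
  have hUk : ∀ k, MemLp (fun u => psiF ψ f θ₀ u k) 2 (P.map Prod.snd) := fun k =>
    hP.memLp_psiF_map.continuousLinearMap_comp (EuclideanSpace.proj (𝕜 := ℝ) k)
  have hωF : ∀ k, MemLp (fun o : Obs d Z => ω k * psiF ψ f θ₀ o.2 k) 2 P := fun k =>
    (hFk k).const_mul _
  have hωU : ∀ k, MemLp (fun u => ω k * psiF ψ f θ₀ u k) 2 (P.map Prod.snd) := fun k =>
    (hUk k).const_mul _
  set b := ∫ v, psiF ψ f θ₀ v ∂P.map Prod.snd with hb
  set a : Fin q → ℝ := fun k => -(matA P ψ θ₀)⁻¹ j k with ha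
  have e1 : influenceL P ψ f ω θ₀ j = fun o => ∑ k, a k *
      (psiY ψ θ₀ o k - ω k * psiF ψ f θ₀ o.2 k) + ∑ k, a k * (ω k * b k) := by
    funext o
    change influenceCLM P ψ θ₀ j (psiY ψ θ₀ o - diagMulL ω (psiFc P ψ f θ₀ o.2)) = _
    rw [influenceCLM_apply_sum, ← Finset.sum_add_distrib]
    refine Finset.sum_congr rfl fun k _ => ?_
    simp only [diagMulL_apply, diagMul, psiFc, PiLp.sub_apply, ← hb]
    ring
  have e2 : influenceU P ψ f ω θ₀ j = fun u => ∑ k, a k * (ω k * psiF ψ f θ₀ u k)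
      + -∑ k, a k * (ω k * b k) := by
    funext u
    change influenceCLM P ψ θ₀ j (diagMulL ω (psiFc P ψ f θ₀ u)) = _
    rw [influenceCLM_apply_sum, ← Finset.sum_neg_distrib, ← Finset.sum_add_distrib]
    refine Finset.sum_congr rfl fun k _ => ?_
    simp only [diagMulL_apply, diagMul, psiFc, PiLp.sub_apply, ← hb]
    ring
  have hYF : ∀ k, MemLp (fun o : Obs d Z => psiY ψ θ₀ o k - ω k * psiF ψ f θ₀ o.2 k) 2 P :=
    fun k => (hYk k).sub (hωF k)
  rw [e1, e2, variance_sum_mul hYF, variance_sum_mul hωU,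
    asympCov_apply, Finset.mul_sum, ← Finset.sum_add_distrib]
  refine Finset.sum_congr rfl fun k _ => ?_
  rw [Finset.mul_sum, ← Finset.sum_add_distrib]
  refine Finset.sum_congr rfl fun l _ => ?_
  rw [covariance_fun_sub_fun_sub (hYk k) (hωF k) (hYk l) (hωF l)]
  simp only [covariance_const_mul_left, covariance_const_mul_right]
  -- Turns the covariance of prediction `k` with outcome `l` into entry `(l, k)` of `M₄`, the source
  -- of the transpose.
  rw [covariance_comm (fun o : Obs d Z => psiF ψ f θ₀ o.2 k)]
  simp only [matM1, matM2, matM3, matM4, Matrix.of_apply, ha]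
  ring

end PopulationConditions

end AsymptoticVariance

/-! ### Coordinatewise asymptotic normality. -/

section AsymptoticNormality

variable {d q : ℕ} {Z : Type*} [MeasurableSpace Z] {P : Measure (Obs d Z)}
  [IsProbabilityMeasure P]
  {ψ : EstFun d q} {f : Z → ℝ} {Θ : Set (EuclideanSpace ℝ (Fin q))}
  {θ₀ ω : EuclideanSpace ℝ (Fin q)} {ρ : ℝ}
  {S : Type*} [MeasurableSpace S] {μ : Measure S} [IsProbabilityMeasure μ]
  {L : ℕ → S → Obs d Z} {U : ℕ → S → UnlabObs d Z} {N : ℕ → ℕ}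

/-- Asymptotic normality of the coordinates of the estimator. -/
lemma PopulationConditions.tendstoInDistribution_estimator
    (hP : PopulationConditions P ψ f Θ θ₀ ω)
    (hdata : IsSample μ P L U) (hN : Tendsto N atTop atTop)
    (hρ : Tendsto (fun n : ℕ => (n : ℝ) / (N n : ℝ)) atTop (𝓝 ρ))
    {ωhat : ℕ → S → EuclideanSpace ℝ (Fin q)}
    (hω : Tendsto (fun p : ℕ × S => ωhat p.1 p.2) (whp μ) (𝓝 ω))
    {θhat : ℕ → S → EuclideanSpace ℝ (Fin q)} (hθmeas : ∀ n, AEMeasurable (θhat n) μ)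
    (hzero : ∀ᶠ p : ℕ × S in whp μ,
      pspaFun ψ f p.1 (N p.1) (fun i => L i p.2) (fun i => U i p.2) (ωhat p.1 p.2)
        (θhat p.1 p.2) = 0 ∧
      ∀ θ ∈ Θ, pspaFun ψ f p.1 (N p.1) (fun i => L i p.2) (fun i => U i p.2) (ωhat p.1 p.2) θ = 0 →
        θ = θhat p.1 p.2) (j : Fin q) :
    TendstoInDistribution (fun (n : ℕ) s => √n * (θhat n s j - θ₀ j)) atTop id
      (fun _ => μ) (gaussianReal 0 (asympCov P ψ f ρ ω θ₀ j j).toNNReal) := by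
  have h1 := hdata.iid_labeled.tendstoInDistribution_add hdata.iid_unlabeled hdata.indep
    (hP.measurable_influenceL j) (hP.memLp_influenceL j) (hP.integral_influenceL j)
    (hP.measurable_influenceU j) (hP.memLp_influenceU j) (hP.integral_influenceU j) hN hρ
  rw [hP.variance_influence] at h1
  have hmeas : ∀ n : ℕ, AEMeasurable (fun s => √n * (θhat n s j - θ₀ j)) μ := fun n => by
    have := hθmeas n
    fun_prop
  refine tendstoInDistribution_of_tendstoInMeasure_sub _ _ h1 ?_ hmeas
  have h2 := ((EuclideanSpace.proj (𝕜 := ℝ) j : EuclideanSpace ℝ (Fin q) →L[ℝ] ℝ).continuous.tendsto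
    0).comp (hP.tendsto_estimator_expansion hdata hN hρ hω hzero)
  rw [map_zero] at h2
  refine tendsto_whp_iff_tendstoInMeasure.1 (h2.congr fun p => ?_)
  have h3 := influenceCLM_scoreTerm (P := P) (ψ := ψ) (f := f) (θ₀ := θ₀) (ω := ω) p.1 (N p.1)
    (fun i => L i p.2) (fun i => U i p.2) j
  rw [influenceCLM_apply] at h3
  rw [Pi.sub_apply, Pi.sub_apply, ← h3]
  simp

end AsymptoticNormality

/-! ### Coverage of the interval. -/

section Wald

/-- Coverage becomes negativity of a continuous function of `√n * (t - θ)` and `√v`, the form needed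
for Slutsky's theorem and the portmanteau theorem. -/
lemma mem_waldInterval_iff {α t v θ : ℝ} {n : ℕ} (hn : n ≠ 0) :
    θ ∈ waldInterval α n t v ↔
      |√n * (t - θ)| - stdNormalQuantile (1 - α / 2) * √v < 0 := by
  have hpos : 0 < √(n : ℝ) := by
    rw [Real.sqrt_pos]
    exact_mod_cast Nat.pos_of_ne_zero hn
  set z := stdNormalQuantile (1 - α / 2)
  have h1 : z * √(v / n) = z * √v / √n := by
    rw [Real.sqrt_div' _ (Nat.cast_nonneg n), mul_div_assoc]
  rw [waldInterval, h1, sub_neg, abs_mul, abs_of_pos hpos, ← lt_div_iff₀' hpos, abs_lt, Set.mem_Ioo]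
  constructor <;> rintro ⟨h2, h3⟩ <;> constructor <;> linarith

/-- Coverage of Wald intervals based on an asymptotically normal estimator and a consistent
variance estimator. -/
lemma tendsto_measureReal_waldInterval {S : Type*} [MeasurableSpace S] {μ : Measure S}
    [IsProbabilityMeasure μ] {t v : ℕ → S → ℝ} {θ σ2 : ℝ} (hσ : 0 < σ2)
    (ht : TendstoInDistribution (fun (n : ℕ) s => √n * (t n s - θ)) atTop id
      (fun _ => μ) (gaussianReal 0 σ2.toNNReal))
    (hvm : ∀ n, AEMeasurable (v n) μ) (hv : TendstoInMeasure μ v atTop fun _ => σ2) (α : ℝ) :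
    Tendsto (fun n => μ.real {s | θ ∈ waldInterval α n (t n s) (v n s)}) atTop
      (𝓝 ((gaussianReal 0 1).real {x | |x| < stdNormalQuantile (1 - α / 2)})) := by
  set z := stdNormalQuantile (1 - α / 2)
  have hv' : TendstoInMeasure μ (fun n s => √(v n s)) atTop fun _ => √σ2 :=
    tendsto_whp_iff_tendstoInMeasure.1
      ((Real.continuous_sqrt.tendsto _).comp (tendsto_whp_iff_tendstoInMeasure.2 hv))
  have h1 := ht.continuous_comp_prodMk_of_tendstoInMeasure_const
    (g := fun p : ℝ × ℝ => |p.1| - z * p.2) (by fun_prop) hv'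
    (fun n => Real.continuous_sqrt.measurable.comp_aemeasurable (hvm n))
  simp only [id] at h1
  have hm : Measurable fun x : ℝ => |x| - z * √σ2 := by fun_prop
  -- The boundary event consists of at most two points, which are null since `σ2 > 0` makes the
  -- Gaussian limit nondegenerate.
  have hnull : ((gaussianReal 0 σ2.toNNReal).map fun x => |x| - z * √σ2) (frontier (Set.Iio 0))
      = 0 := by
    have : NullSingletonClass (gaussianReal 0 σ2.toNNReal) :=
      nullSingletonClass_gaussianReal (by simpa using hσ)
    rw [frontier_Iio, Measure.map_apply hm (measurableSet_singleton 0)]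
    refine measure_mono_null (t := {z * √σ2, -(z * √σ2)}) (fun x hx => ?_)
      ((Set.toFinite _).measure_zero _)
    simp only [Set.mem_preimage, Set.mem_singleton_iff, sub_eq_zero] at hx
    exact eq_or_eq_neg_of_abs_eq hx
  have h2 := ProbabilityMeasure.tendsto_measure_of_null_frontier_of_tendsto' h1.tendsto hnull
  simp only [ProbabilityMeasure.coe_mk] at h2
  have h3 := (ENNReal.tendsto_toReal (measure_ne_top _ _)).comp h2
  rw [Measure.map_apply hm measurableSet_Iio] at h3
  have h4 : (gaussianReal 0 1).real {x | |x| < z}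
      = ((gaussianReal 0 σ2.toNNReal) ((fun x => |x| - z * √σ2) ⁻¹' Set.Iio 0)).toReal := by
    rw [← gaussianReal_toNNReal_real_abs_lt hσ, measureReal_def]
    congr 2
    ext x
    simp
  rw [h4]
  refine h3.congr' ?_
  filter_upwards [eventually_ne_atTop 0] with n hn
  rw [Function.comp_apply, Measure.map_apply_of_aemeasurable (h1.forall_aemeasurable n)
    measurableSet_Iio, measureReal_def]
  congr 2
  ext s
  exact (mem_waldInterval_iff hn).symm

end Wald

theorem corollary2 {d q : ℕ} {Z : Type*} [MeasurableSpace Z]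
    -- population, estimating function, prediction rule, parameter, limiting weights
    (P : Measure (Obs d Z)) [IsProbabilityMeasure P]
    (ψ : EstFun d q) (f : Z → ℝ) (Θ : Set (EuclideanSpace ℝ (Fin q)))
    (θ₀ ω : EuclideanSpace ℝ (Fin q))
    (hP : PopulationConditions P ψ f Θ θ₀ ω)
    -- labeled and unlabeled data
    {S : Type*} [MeasurableSpace S] (μ : Measure S) [IsProbabilityMeasure μ]
    (L : ℕ → S → Obs d Z) (U : ℕ → S → UnlabObs d Z) (hdata : IsSample μ P L U)
    -- `n` labeled and `N n` unlabeled observations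
    (N : ℕ → ℕ) (hN : Tendsto N atTop atTop)
    (ρ : ℝ) (hρ : Tendsto (fun n : ℕ => (n : ℝ) / (N n : ℝ)) atTop (𝓝 ρ))
    -- consistent weights
    (ωhat : ℕ → S → EuclideanSpace ℝ (Fin q)) (hωmeas : ∀ n, AEMeasurable (ωhat n) μ)
    (hω : TendstoInMeasure μ ωhat atTop (fun _ => ω))
    -- with probability tending to one, the sample estimating function is continuous and has
    -- a unique zero in the parameter space
    (hsol : Tendsto (fun n => μ {s | ¬ (
        ContinuousOn (pspaFun ψ f n (N n) (fun i => L i s) (fun i => U i s) (ωhat n s)) Θ ∧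
        ∃! θ, θ ∈ Θ ∧
          pspaFun ψ f n (N n) (fun i => L i s) (fun i => U i s) (ωhat n s) θ = 0)})
      atTop (𝓝 0))
    -- the estimator solves the sample estimating equation whenever it has a solution
    (θhat : ℕ → S → EuclideanSpace ℝ (Fin q)) (hθmeas : ∀ n, AEMeasurable (θhat n) μ)
    (hθ : ∀ n, ∀ᵐ s ∂μ,
      (∃ θ ∈ Θ, pspaFun ψ f n (N n) (fun i => L i s) (fun i => U i s) (ωhat n s) θ = 0) →
      θhat n s ∈ Θ ∧
        pspaFun ψ f n (N n) (fun i => L i s) (fun i => U i s) (ωhat n s) (θhat n s) = 0)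
    -- consistent estimator of the asymptotic covariance matrix
    (covHat : ℕ → S → Matrix (Fin q) (Fin q) ℝ)
    (hcovMeas : ∀ n i j, AEMeasurable (fun s => covHat n s i j) μ)
    (hcov : ∀ i j, TendstoInMeasure μ (fun n s => covHat n s i j) atTop
      (fun _ => asympCov P ψ f ρ ω θ₀ i j))
    (α : ℝ) (hα0 : 0 < α) (hα1 : α < 1)
    (j : Fin q) (hj : 0 < asympCov P ψ f ρ ω θ₀ j j) :
    ∃ l : ℝ, 1 - α ≤ l ∧
      Tendsto (fun n => μ.real {s | θ₀ j ∈ waldInterval α n (θhat n s j) (covHat n s j j)})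
        atTop (𝓝 l) := by
  have hω' := tendsto_whp_iff_tendstoInMeasure.2 hω
  have hzero : ∀ᶠ p : ℕ × S in whp μ,
      pspaFun ψ f p.1 (N p.1) (fun i => L i p.2) (fun i => U i p.2) (ωhat p.1 p.2)
        (θhat p.1 p.2) = 0 ∧
      ∀ θ ∈ Θ, pspaFun ψ f p.1 (N p.1) (fun i => L i p.2) (fun i => U i p.2) (ωhat p.1 p.2) θ = 0 →
        θ = θhat p.1 p.2 := by
    filter_upwards [eventually_whp_of_tendsto hsol, eventually_whp_of_ae hθ] with p hp hpθ
    obtain ⟨-, θ, hθΘ, huniq⟩ := hp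
    have h := hpθ ⟨θ, hθΘ.1, hθΘ.2⟩
    exact ⟨h.2, fun θ' hθ' h0 => (huniq θ' ⟨hθ', h0⟩).trans (huniq _ h).symm⟩
  exact ⟨_, one_sub_le_gaussianReal_abs_lt hα0, tendsto_measureReal_waldInterval hj
    (hP.tendstoInDistribution_estimator hdata hN hρ hω' hθmeas hzero j)
    (fun n => hcovMeas n j j) (hcov j j) α⟩
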